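/- **Setting.** Let $G=(V,E)$ be a directed graph on $V=\{1,\dots,m\}$ with $m'=|E|\ge 1$ edges. Let $\Delta$ be the maximum over all vertices of the in-degrees and the out-degrees, and let $d_{\rm avg}=m'/m$. Let $d=d_{\rm model}\ge 1$ be an integer. *Random data.* Let $X\in\mathbb R^{m\times d}$ have as rows $\mathbf x_i=\tilde{\mathbf x}_i/\|\tilde{\mathbf x}_i\|_2$, where the $\tilde{\mathbf x}_i\sim\mathcal N(0,I/d)$ are i.i.d. Let $W\in\{\pm1\}^{m\times d_k}$ be independent of $X$, with i.i.d. Rademacher entries and rows $\mathbf w_j$. *Construction.* The construction with $h$ heads of width $d_k$ uses a partition of $E$ into $h$ pairwise disjoint matchings $M_1,\dots,M_h$ with at most $d$ edges each; in a matching no two edges share a source or share a target. For head $k$ let $V_k,T_k$ be the sources and the targets of the edges of $M_k$, and let $\pi_k:V_k\to T_k$ be the bijection given by $M_k$. Let $W'_{Q,(k)}$ be the $m\times d_k$ matrix whose row $i$ is $\mathbf w_{\pi_k(i)}$ if $i\in V_k$ and $0$ otherwise. Let $W'_{K,(k)}$ be the one whose row $j$ is $\mathbf w_j$ if $j\in T_k$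 and $0$ otherwise. Put $$W_Q^{(k)}=X^\top W'_{Q,(k)},\quad W_K^{(k)}=X^\top W'_{K,(k)},\quad S^{(k)}_{ij}=\langle \mathbf x_iW_Q^{(k)},\mathbf x_jW_K^{(k)}\rangle,\quad S^{\max}_{ij}=\max_k S^{(k)}_{ij},\quad \tau=\tfrac12 d_k .$$ The total key dimension is $D_K=h\,d_k$. **Corollary (Bounded Skew).** The condition $\Delta/d_{\rm avg}\le m/d$ is equivalent to $\Delta\le m'/d$. There are absolute constants $c_0,C_0>0$ such that, for every $C\ge C_0$, the following holds for all $m$, $d$, $G$ with $d\ge c_0\log m$ and $\Delta/d_{\rm avg}\le m/d$. Take $h=\lceil m'/d\rceil$ and $d_k=\lceil C\log m\rceil$. 1. A partition of $E$ into $h$ matchings with at most $d$ edges each exists. For every such partition, with probability at least $1-m^{-3}$ over $(X,W)$, simultaneously for all ordered pairs $(i,j)$: $S^{\max}_{ij}>\tau$ if $(i,j)\in E$, and $S^{\max}_{ij}<\tau$ if $(i,j)\notin E$. (Diagonal pairs $(i,i)\notin E$ are included if $G$ has no loops; if $G$ has loops, the second inequality is claimed for the pairs with $i\ne j$.) 2.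 $D_K=\Theta(m'\log m/d)$ and $D_K=\Omega(m'\log m'/d)$, with constants that depend only on $C$. For every fixed $\delta>0$, on the graphs with $m'\ge m^{\delta}$ one has $$D_K=\Theta\!\left(\frac{m'\log m'}{d}\right),$$ with constants that depend only on $C$ and $\delta$. 3. This matches the information-theoretic lower-bound rate $\frac{m'}{d}\log\frac{m^2}{m'}$ when $m'=O(m^{2-\varepsilon})$: for all $\varepsilon,K>0$ one has $$D_K=\Theta\!\left(\frac{m'}{d}\log\frac{m^2}{m'}\right)$$ for all sufficiently large $m$ and all such graphs with $m'\le K m^{2-\varepsilon}$, where the constants and the meaning of "sufficiently large" depend only on $C,\varepsilon,K$. -/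

import Mathlib

open MeasureTheory ProbabilityTheory

noncomputable section

namespace RGR

/-! ### Directed graphs on `m` items: edges, degrees, skew -/

open Classical in
/-- The edge set `E` of a directed graph on `m` items. -/
def edges {m : ℕ} (G : Digraph (Fin m)) : Finset (Fin m × Fin m) :=
  Finset.univ.filter fun p => G.Adj p.1 p.2

/-- The number `m'` of edges. -/
def numEdges {m : ℕ} (G : Digraph (Fin m)) : ℕ := (edges G).card

/-- The out-degree of a vertex. -/
def outDegree {m : ℕ} (G : Digraph (Fin m)) (i : Fin m) : ℕ :=
  ((edges G).filter fun p => p.1 = i).card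

/-- The in-degree of a vertex. -/
def inDegree {m : ℕ} (G : Digraph (Fin m)) (j : Fin m) : ℕ :=
  ((edges G).filter fun p => p.2 = j).card

/-- `Δ`, the maximum over all vertices of the out-degrees and the in-degrees. -/
def maxDegree {m : ℕ} (G : Digraph (Fin m)) : ℕ :=
  max (Finset.univ.sup (outDegree G)) (Finset.univ.sup (inDegree G))

/-- The average degree `d_avg = m' / m`. -/
def avgDegree {m : ℕ} (G : Digraph (Fin m)) : ℝ := (numEdges G : ℝ) / m

/-- The bounded skew condition `Δ / d_avg ≤ m / d_model`. -/
def BoundedSkew {m : ℕ} (d : ℕ) (G : Digraph (Fin m)) : Prop :=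
  (maxDegree G : ℝ) / avgDegree G ≤ (m : ℝ) / d

/-! ### Packing the edges into matchings -/

/-- A set of directed edges is a matching if no two of its edges share a source or a target. -/
def IsMatching {m : ℕ} (M : Finset (Fin m × Fin m)) : Prop :=
  ∀ p ∈ M, ∀ q ∈ M, (p.1 = q.1 ∨ p.2 = q.2) → p = q

/-- `M 0, …, M (h - 1)` partition the edge set of `G` into `h` disjoint matchings with at most `d`
edges each. -/
structure IsPacking {m : ℕ} (G : Digraph (Fin m)) (d h : ℕ)
    (M : Fin h → Finset (Fin m × Fin m)) : Prop where
  disjoint : ∀ k l, k ≠ l → Disjoint (M k) (M l)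
  union : Finset.univ.biUnion M = edges G
  matching : ∀ k, IsMatching (M k)
  card_le : ∀ k, (M k).card ≤ d

/-! ### The random embedding and the random signatures -/

/-- The law of an `m × d` matrix with i.i.d. rows distributed as `N(0, I / d)`. -/
def gaussianRows (m d : ℕ) : Measure (Fin m → Fin d → ℝ) :=
  Measure.pi fun _ => Measure.pi fun _ => gaussianReal 0 ((d : NNReal)⁻¹)

/-- The Rademacher law: `1` and `-1` with probability one half each. -/
def rademacher : Measure ℝ :=
  (2⁻¹ : ENNReal) • (Measure.dirac 1 + Measure.dirac (-1))

/-- The law of an `m × n` matrix with i.i.d. Rademacher entries. -/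
def signatureLaw (m n : ℕ) : Measure (Fin m → Fin n → ℝ) :=
  Measure.pi fun _ => Measure.pi fun _ => rademacher

/-- The joint law of the unnormalised Gaussian embedding and of the independent signature matrix. -/
def constructionLaw (m d n : ℕ) :
    Measure ((Fin m → Fin d → ℝ) × (Fin m → Fin n → ℝ)) :=
  (gaussianRows m d).prod (signatureLaw m n)

instance : IsProbabilityMeasure rademacher := by
  refine ⟨?_⟩
  simp only [rademacher, Measure.smul_apply, Measure.add_apply, measure_univ, smul_eq_mul]
  rw [one_add_one_eq_two]
  exact ENNReal.inv_mul_cancel (by simp) (by simp)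

instance (m d : ℕ) : IsProbabilityMeasure (gaussianRows m d) := by
  unfold gaussianRows; infer_instance

instance (m n : ℕ) : IsProbabilityMeasure (signatureLaw m n) := by
  unfold signatureLaw; infer_instance

instance (m d n : ℕ) : IsProbabilityMeasure (constructionLaw m d n) := by
  unfold constructionLaw; infer_instance

/-- The embedding matrix `X`: every row of `Z` divided by its Euclidean norm. -/
def normalizeRows {m d : ℕ} (Z : Fin m → Fin d → ℝ) : Matrix (Fin m) (Fin d) ℝ :=
  Matrix.of fun i a => Z i a / √(∑ b, Z i b ^ 2)

/-! ### The attention heads -/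

/-- The query template of a head serving the matching `M`, with bijection `π : V_M → T_M`: row `i`
is the signature `w (π i)` if `i` is the source of an edge of `M`, and `0` otherwise. (For a
matching the sum below has at most one term, the one of the edge `(i, π i)`.) -/
def queryTemplate {m n : ℕ} (M : Finset (Fin m × Fin m)) (w : Fin m → Fin n → ℝ) :
    Matrix (Fin m) (Fin n) ℝ :=
  Matrix.of fun i => ∑ p ∈ M.filter (fun p => p.1 = i), w p.2

/-- The key template of a head serving `M`: row `j` is the signature `w j` if `j` is the target of
an edge of `M`, and `0` otherwise. -/
def keyTemplate {m n : ℕ} (M : Finset (Fin m × Fin m)) (w : Fin m → Fin n → ℝ) :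
    Matrix (Fin m) (Fin n) ℝ :=
  Matrix.of fun j => if j ∈ M.image Prod.snd then w j else 0

/-- The query projection `W_Q = Xᵀ W'_Q` of a head. -/
def queryWeights {m d n : ℕ} (X : Matrix (Fin m) (Fin d) ℝ) (M : Finset (Fin m × Fin m))
    (w : Fin m → Fin n → ℝ) : Matrix (Fin d) (Fin n) ℝ :=
  X.transpose * queryTemplate M w

/-- The key projection `W_K = Xᵀ W'_K` of a head. -/
def keyWeights {m d n : ℕ} (X : Matrix (Fin m) (Fin d) ℝ) (M : Finset (Fin m × Fin m))
    (w : Fin m → Fin n → ℝ) : Matrix (Fin d) (Fin n) ℝ :=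
  X.transpose * keyTemplate M w

/-- The score `⟨x_i W_Q, x_j W_K⟩` that a head with projections `WQ`, `WK` gives to the ordered
pair `(i, j)`. -/
def headScore {m d n : ℕ} (X : Matrix (Fin m) (Fin d) ℝ) (WQ WK : Matrix (Fin d) (Fin n) ℝ)
    (i j : Fin m) : ℝ :=
  dotProduct ((X * WQ) i) ((X * WK) j)

/-- The maximum over the `h` heads of the scores of `(i, j)`, in the construction that is built on
the matchings `M 0, …, M (h - 1)`, the embedding `X` and the signatures `w`. -/
def maxScore {m d n h : ℕ} (X : Matrix (Fin m) (Fin d) ℝ) (M : Fin h → Finset (Fin m × Fin m))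
    (w : Fin m → Fin n → ℝ) (i j : Fin m) : ℝ :=
  ⨆ k : Fin h, headScore X (queryWeights X (M k) w) (keyWeights X (M k) w) i j

/-- The scores `S` separate the edges of `G` from the non-edges at threshold `τ`. Pairs `(i, i)`
count as non-edges only if `G` has no loops at all. -/
def Separates {m : ℕ} (G : Digraph (Fin m)) (S : Fin m → Fin m → ℝ) (τ : ℝ) : Prop :=
  ∀ i j, (G.Adj i j → τ < S i j) ∧
    (¬ G.Adj i j → (i ≠ j ∨ ∀ v, ¬ G.Adj v v) → S i j < τ)

/-! ### Parameters -/

/-- The number `h₀ = ⌈m' / d_model⌉` of heads. -/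
def numHeads {m : ℕ} (d : ℕ) (G : Digraph (Fin m)) : ℕ := ⌈(numEdges G : ℝ) / d⌉₊

/-- The width `d_k = C log m` of a head, rounded up to an integer. -/
def headWidth (C : ℝ) (m : ℕ) : ℕ := ⌈C * Real.log m⌉₊

/-- The total key dimension `D_K = h₀ d_k`. -/
def totalKeyDim {m : ℕ} (C : ℝ) (d : ℕ) (G : Digraph (Fin m)) : ℕ :=
  numHeads d G * headWidth C m

/-- The standing hypotheses: there is an edge, `d_model ≥ c₀ log m`, and the skew is bounded. -/
structure Admissible {m : ℕ} (c₀ : ℝ) (d : ℕ) (G : Digraph (Fin m)) : Prop where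
  edges_pos : 0 < numEdges G
  dim_ge : c₀ * Real.log m ≤ d
  skew : BoundedSkew d G

end RGR

end

namespace RGR

/-! ### Packing the edges into bounded matchings -/

/-! For one head with matching M, write g(i, a) = ⟨x_i, x_a⟩. The query of i is the sum of g(i, a)
w_b over the edges (a, b) of M, and the key of j is the sum of g(j, b) w_b over the same edges.
Distinct signatures are nearly orthogonal, so the score of (i, j) is about d_k times the sum of g(i,
a) g(j, b) over (a, b) ∈ M. If (i, j) ∈ M, this sum contains the term 1. The rest is noise:
off-diagonal Gram entries have order d^(-1/2), and at most d products of two of them, of random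
sign, cancel. The sum is therefore at least 3/4 on M and at most 1/4 off M
(`IsMatching.gram_sum_bounds`). Conditionally on X the signatures add an error below d_k / 8
(`measureReal_signature_le`), so d_k / 2 separates in each head, hence also for the maximum. The
exception is i = j with loops in M: the terms g(i, a)² are nonnegative and do not cancel.

All failure probabilities come from Bernstein's inequality and are exponentially small in d or d_k.
With both at least a large multiple of log m, they survive a union bound over O(m² h) events. Three
devices supply the independence. Directions of short rows are replaced by 0 (`cappedDir`), which
makes the normalised rows dominated by Gaussian ones and keeps their symmetries. Rows i and j are
frozen (`pi_measureReal_le_of_forall_piecewise`). Since edges of M may share a row when one starts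
where another ends, M is split into loops and three colour classes with disjoint endpoints.

The packing exists because bounded skew says Δ ≤ m' / d ≤ h. König's theorem then gives h matchings,
and padding the bipartite graph to a regular multigraph with dummy vertices forces every class to
have at most d real edges (`exists_isPacking`). The asymptotics of D_K hold because m' / d ≥ Δ ≥ 1,
so the ceilings cost only constant factors, and log m', log (m² / m') are comparable with log m in
the stated ranges. -/

theorem card_filter_mem_of_fibers {V E : Type*} [DecidableEq V] (F : Finset E) (s : E → V)
    (A : Finset V) {n : ℕ} (hs : ∀ v, (F.filter fun e => s e = v).card = n) :
    (F.filter fun e => s e ∈ A).card = A.card * n := by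
  rw [Finset.card_eq_sum_card_fiberwise (s := F.filter fun e => s e ∈ A) (f := s) (t := A)
    (fun e he => (Finset.mem_filter.1 he).2), ← smul_eq_mul, ← Finset.sum_const]
  refine Finset.sum_congr rfl fun v hv => ?_
  rw [← hs v, Finset.filter_filter]
  congr 1
  ext e
  simp only [Finset.mem_filter]
  constructor
  · rintro ⟨a, b, c⟩; exact ⟨a, c⟩
  · rintro ⟨a, c⟩; exact ⟨a, c ▸ hv, c⟩

/-- **König's edge colouring theorem** for regular bipartite multigraphs: the edges `F`, with
endpoints given by `s` and `t`, split into `h` colour classes without common endpoints. -/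
theorem exists_coloring_of_regular {V W E : Type*} [Fintype V] [Fintype W]
    [DecidableEq V] [DecidableEq W]
    (hVW : Fintype.card V = Fintype.card W) (s : E → V) (t : E → W) (h : ℕ) (F : Finset E)
    (hs : ∀ v, (F.filter fun e => s e = v).card = h)
    (ht : ∀ w, (F.filter fun e => t e = w).card = h) :
    ∃ c : E → ℕ, (∀ e ∈ F, c e < h) ∧
      ∀ e ∈ F, ∀ e' ∈ F, c e = c e' → (s e = s e' ∨ t e = t e') → e = e' := by
  classical
  induction h generalizing F with
  | zero =>
    have hF : ∀ e, e ∉ F := fun e he => by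
      have := Finset.card_eq_zero.1 (hs (s e))
      exact Finset.notMem_empty e (this ▸ Finset.mem_filter.2 ⟨he, rfl⟩)
    exact ⟨fun _ => 0, fun e he => absurd he (hF e), fun e he => absurd he (hF e)⟩
  | succ h ih =>
    -- Hall's condition by double counting: the (h + 1)|A| edges leaving A all end in its
    -- neighbourhood B, which receives (h + 1)|B| edges.
    have hall : ∀ A : Finset V,
        A.card ≤ (A.biUnion fun v => (F.filter fun e => s e = v).image t).card := by
      intro A
      set B := A.biUnion fun v => (F.filter fun e => s e = v).image t with hB
      have h1 := card_filter_mem_of_fibers F s A hs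
      have h2 := card_filter_mem_of_fibers F t B ht
      have h3 : (F.filter fun e => s e ∈ A).card ≤ (F.filter fun e => t e ∈ B).card := by
        refine Finset.card_le_card fun e he => ?_
        rw [Finset.mem_filter] at he ⊢
        exact ⟨he.1, Finset.mem_biUnion.2 ⟨s e, he.2,
          Finset.mem_image.2 ⟨e, Finset.mem_filter.2 ⟨he.1, rfl⟩, rfl⟩⟩⟩
      rw [h1, h2] at h3
      exact Nat.le_of_mul_le_mul_right h3 (Nat.succ_pos h)
    obtain ⟨f, hfinj, hf⟩ := (Finset.all_card_le_biUnion_card_iff_exists_injective _).1 hall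
    have hfsurj : Function.Surjective f :=
      ((Fintype.bijective_iff_injective_and_card f).2 ⟨hfinj, hVW⟩).2
    have hf' : ∀ v, ∃ e ∈ F, s e = v ∧ t e = f v := fun v => by
      obtain ⟨e, he, het⟩ := Finset.mem_image.1 (hf v)
      exact ⟨e, (Finset.mem_filter.1 he).1, (Finset.mem_filter.1 he).2, het⟩
    choose e heF hes het using hf'
    set P := Finset.univ.image e with hP
    have hmemP : ∀ x, x ∈ P ↔ e (s x) = x := fun x => by
      rw [hP, Finset.mem_image]
      constructor
      · rintro ⟨v, -, rfl⟩; rw [hes]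
      · intro hx; exact ⟨s x, Finset.mem_univ _, hx⟩
    have hPt : ∀ x ∈ P, f (s x) = t x := fun x hx => by
      rw [← het (s x), (hmemP x).1 hx]
    have hs' : ∀ v, ((F \ P).filter fun x => s x = v).card = h := by
      intro v
      have : (F \ P).filter (fun x => s x = v) = (F.filter fun x => s x = v).erase (e v) := by
        ext x
        simp only [Finset.mem_filter, Finset.mem_sdiff, Finset.mem_erase, hmemP]
        constructor
        · rintro ⟨⟨a, b⟩, rfl⟩; exact ⟨fun hx => b hx.symm, a, rfl⟩
        · rintro ⟨a, b, rfl⟩; exact ⟨⟨b, fun hx => a hx.symm⟩, rfl⟩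
      rw [this, Finset.card_erase_of_mem (Finset.mem_filter.2 ⟨heF v, hes v⟩), hs,
        Nat.add_sub_cancel]
    have ht' : ∀ w, ((F \ P).filter fun x => t x = w).card = h := by
      intro w
      obtain ⟨v, rfl⟩ := hfsurj w
      have : (F \ P).filter (fun x => t x = f v) = (F.filter fun x => t x = f v).erase (e v) := by
        ext x
        simp only [Finset.mem_filter, Finset.mem_sdiff, Finset.mem_erase]
        constructor
        · rintro ⟨⟨a, b⟩, c⟩
          exact ⟨fun hx => b (by rw [hx, hmemP, hes]), a, c⟩
        · rintro ⟨a, b, c⟩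
          refine ⟨⟨b, fun hx => a ?_⟩, c⟩
          rw [← (hmemP x).1 hx, hfinj ((hPt x hx).trans c)]
      rw [this, Finset.card_erase_of_mem (Finset.mem_filter.2 ⟨heF v, het v⟩), ht,
        Nat.add_sub_cancel]
    obtain ⟨c, hc, hcc⟩ := ih (F \ P) hs' ht'
    -- The perfect matching `P` takes the new colour h; removing it lowers every degree by one, and
    -- the remaining colours are below h.
    refine ⟨fun x => if x ∈ P then h else c x, fun x hx => ?_, fun x hx y hy hxy hst => ?_⟩
    · by_cases hxP : x ∈ P
      · simp [hxP]
      · simpa [hxP] using (hc x (Finset.mem_sdiff.2 ⟨hx, hxP⟩)).trans (Nat.lt_succ_self h)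
    · by_cases hxP : x ∈ P <;> by_cases hyP : y ∈ P
      · have hs0 : s x = s y := by
          rcases hst with hst | hst
          · exact hst
          · exact hfinj (by rw [hPt x hxP, hPt y hyP, hst])
        rw [← (hmemP x).1 hxP, ← (hmemP y).1 hyP, hs0]
      · simp only [hxP, hyP, if_true, if_false] at hxy
        exact absurd hxy (hc y (Finset.mem_sdiff.2 ⟨hy, hyP⟩)).ne'
      · simp only [hxP, hyP, if_true, if_false] at hxy
        exact absurd hxy (hc x (Finset.mem_sdiff.2 ⟨hx, hxP⟩)).ne
      · simp only [hxP, hyP, if_false] at hxy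
        exact hcc x (Finset.mem_sdiff.2 ⟨hx, hxP⟩) y (Finset.mem_sdiff.2 ⟨hy, hyP⟩) hxy hst

/-- If the fibres of `f` on `F` have at most `h` elements, then the elements of `F` can be given
pairwise distinct slots `(f e, x)` with `x < h`. -/
theorem exists_slots {V E : Type*} [DecidableEq V] (F : Finset E) (f : E → V) (h : ℕ)
    (hf : ∀ v, (F.filter fun e => f e = v).card ≤ h) :
    ∃ g : F → V × Fin h, Function.Injective g ∧ ∀ e, (g e).1 = f e := by
  have key : ∀ v, Nonempty ({e // e ∈ F.filter fun e => f e = v} ↪ Fin h) := fun v =>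
    Function.Embedding.nonempty_of_card_le (by simpa using hf v)
  let ψ := fun v => (key v).some
  refine ⟨fun e => (f e, ψ (f e) ⟨e, Finset.mem_filter.2 ⟨e.2, rfl⟩⟩), ?_, fun e => rfl⟩
  rintro ⟨x, hx⟩ ⟨y, hy⟩ hxy
  simp only [Prod.mk.injEq] at hxy
  obtain ⟨h1, h2⟩ := hxy
  have h3 : ∀ v (hv : f x = v), ψ v ⟨x, Finset.mem_filter.2 ⟨hx, hv⟩⟩ =
      ψ (f x) ⟨x, Finset.mem_filter.2 ⟨hx, rfl⟩⟩ := by rintro v rfl; rfl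
  rw [← h3 _ h1] at h2
  have := (ψ (f y)).injective h2
  simpa using this

/-- Two injections into a finite type differ by a permutation. -/
theorem exists_perm_comp_eq {A B : Type*} [Finite B] {p q : A → B} (hp : Function.Injective p)
    (hq : Function.Injective q) : ∃ Φ : Equiv.Perm B, ∀ x, Φ (p x) = q x := by
  classical
  let e : {b // b ∈ Set.range p} ≃ {b // b ∈ Set.range q} :=
    (Equiv.ofInjective p hp).symm.trans (Equiv.ofInjective q hq)
  refine ⟨e.extendSubtype, fun x => ?_⟩
  rw [Equiv.extendSubtype_apply_of_mem _ _ ⟨x, rfl⟩]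
  have : (Equiv.ofInjective p hp).symm ⟨p x, ⟨x, rfl⟩⟩ = x := by
    rw [Equiv.symm_apply_eq]; rfl
  simp only [e, Equiv.trans_apply, this, Equiv.ofInjective_apply]

/-- König alone does not bound the classes by d. Each side receives m - d dummy vertices of degree
h, and every dummy source is joined only to real targets. In a colour class, which is a perfect
matching of the padded graph, the m - d dummy targets must then use up m - d real sources, leaving
at most d of them for edges of G. -/
theorem exists_isPacking {m : ℕ} (G : Digraph (Fin m)) (d h : ℕ) (hdm : d ≤ m)
    (hdeg : maxDegree G ≤ h) (hcard : numEdges G ≤ h * d) :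
    ∃ M : Fin h → Finset (Fin m × Fin m), IsPacking G d h M := by
  classical
  obtain ⟨a, ha, ha1⟩ := exists_slots (edges G) Prod.fst h fun v =>
    (Finset.le_sup (f := outDegree G) (Finset.mem_univ v)).trans ((le_max_left _ _).trans hdeg)
  obtain ⟨b, hb, hb1⟩ := exists_slots (edges G) Prod.snd h fun v =>
    (Finset.le_sup (f := inDegree G) (Finset.mem_univ v)).trans ((le_max_right _ _).trans hdeg)
  -- The real targets have m h - m' free slots, and m' ≤ h d makes this at least (m - d) h, enough
  -- for all slots of the dummy sources.
  obtain ⟨z⟩ : Nonempty (Fin (m - d) × Fin h ↪ {y : Fin m × Fin h // y ∉ Set.range b}) := by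
    refine Function.Embedding.nonempty_of_card_le ?_
    have h1 : Fintype.card {y : Fin m × Fin h // y ∈ Set.range b} = numEdges G := by
      rw [← Fintype.card_congr (Equiv.ofInjective b hb), Fintype.card_coe]; rfl
    rw [Fintype.card_subtype_compl, h1]
    simp only [Fintype.card_prod, Fintype.card_fin]
    rw [Nat.sub_mul, mul_comm d h]
    omega
  let V := Fin m ⊕ Fin (m - d)
  let p : edges G ⊕ (Fin (m - d) × Fin h) → V × Fin h :=
    Sum.elim (fun e => (Sum.inl (a e).1, (a e).2)) (fun x => (Sum.inr x.1, x.2))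
  let q : edges G ⊕ (Fin (m - d) × Fin h) → V × Fin h :=
    Sum.elim (fun e => (Sum.inl (b e).1, (b e).2)) (fun x => (Sum.inl (z x).1.1, (z x).1.2))
  have hp : Function.Injective p := by
    rintro (x | x) (y | y) hxy <;> simp only [p, Sum.elim_inl, Sum.elim_inr, Prod.mk.injEq,
      reduceCtorEq, false_and] at hxy
    · rw [ha (Prod.ext (Sum.inl.inj hxy.1) hxy.2)]
    · rw [Prod.ext (Sum.inr.inj hxy.1) hxy.2]
  have hq : Function.Injective q := by
    rintro (x | x) (y | y) hxy <;> simp only [q, Sum.elim_inl, Sum.elim_inr, Prod.mk.injEq] at hxy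
    · rw [hb (Prod.ext (Sum.inl.inj hxy.1) hxy.2)]
    · exact absurd ⟨x, Prod.ext (Sum.inl.inj hxy.1) hxy.2⟩ (z y).2
    · exact absurd ⟨y, (Prod.ext (Sum.inl.inj hxy.1) hxy.2).symm⟩ (z x).2
    · rw [z.injective (Subtype.ext (Prod.ext (Sum.inl.inj hxy.1) hxy.2))]
  -- A permutation of the slots is an h-regular bipartite multigraph: the edge at source slot x ends
  -- at target slot `Φ x`. Extending the partial assignment fills all remaining slots at once.
  obtain ⟨Φ, hΦ⟩ := exists_perm_comp_eq hp hq
  have hfib : ∀ v : V, (Finset.univ.filter fun x : V × Fin h => x.1 = v).card = h := by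
    intro v
    have : (Finset.univ.filter fun x : V × Fin h => x.1 = v) = {v} ×ˢ Finset.univ := by
      ext x
      simp only [Finset.mem_filter, Finset.mem_univ, true_and, Finset.mem_product,
        Finset.mem_singleton, and_true]
    rw [this, Finset.card_product]; simp
  obtain ⟨c, hc, hcc⟩ := exists_coloring_of_regular (V := V) (W := V) rfl
    (fun x : V × Fin h => x.1) (fun x => (Φ x).1) h Finset.univ hfib fun w => by
      refine (?_ : _ = _).trans (hfib w)
      exact Finset.card_bij (fun x _ => Φ x) (by simp) (by simp)
        (fun y hy => ⟨Φ.symm y, by simpa using hy, by simp⟩)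
  -- The h edges at a target have distinct colours among h, so every colour occurs there.
  have hcol : ∀ (w : V) (k : Fin h), ∃ x : V × Fin h, (Φ x).1 = w ∧ c x = k := by
    intro w k
    let g : Fin h → Fin h := fun x => ⟨c (Φ.symm (w, x)), hc _ (Finset.mem_univ _)⟩
    have hg : Function.Injective g := fun x y hxy => by
      have := hcc (Φ.symm (w, x)) (Finset.mem_univ _) (Φ.symm (w, y)) (Finset.mem_univ _)
        (by simpa [g] using hxy) (Or.inr (by simp))
      simpa using this
    obtain ⟨x, hx⟩ := (Finite.injective_iff_surjective.1 hg) k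
    exact ⟨Φ.symm (w, x), by simp, by simpa [g] using congrArg Fin.val hx⟩
  let M : Fin h → Finset (Fin m × Fin m) := fun k =>
    (Finset.univ.filter fun e : edges G => c (p (Sum.inl e)) = k).map (Function.Embedding.subtype _)
  have hM : ∀ k e, e ∈ M k ↔ ∃ he : e ∈ edges G, c (p (Sum.inl ⟨e, he⟩)) = k := by
    intro k e; simp [M]
  have hpfst : ∀ e : edges G, (p (Sum.inl e)).1 = Sum.inl e.1.1 := fun e => by simp [p, ha1]
  have hpsnd : ∀ e : edges G, (Φ (p (Sum.inl e))).1 = Sum.inl e.1.2 := fun e => by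
    rw [hΦ]; simp [q, hb1]
  have hmatch : ∀ k, IsMatching (M k) := by
    intro k e he e' he' hee
    obtain ⟨h1, h2⟩ := (hM k e).1 he
    obtain ⟨h1', h2'⟩ := (hM k e').1 he'
    have := hcc _ (Finset.mem_univ (p (Sum.inl ⟨e, h1⟩))) _
      (Finset.mem_univ (p (Sum.inl ⟨e', h1'⟩)))
      (h2.trans h2'.symm) (by
        simp only [hpfst, hpsnd]
        rcases hee with hee | hee
        · exact Or.inl (by rw [hee])
        · exact Or.inr (by rw [hee]))
    simpa using hp this
  refine ⟨M, ⟨fun k l hkl => ?_, ?_, hmatch, fun k => ?_⟩⟩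
  · rw [Finset.disjoint_left]
    intro e hk hl
    obtain ⟨h1, h2⟩ := (hM k e).1 hk
    obtain ⟨h1', h2'⟩ := (hM l e).1 hl
    exact hkl (Fin.ext (h2.symm.trans h2'))
  · ext e
    simp only [Finset.mem_biUnion, Finset.mem_univ, true_and, hM]
    constructor
    · rintro ⟨k, he, -⟩; exact he
    · intro he; exact ⟨⟨_, hc _ (Finset.mem_univ (p (Sum.inl ⟨e, he⟩)))⟩, he, rfl⟩
  · have hx : ∀ l : Fin (m - d), ∃ x : V × Fin h, ∃ i : Fin m,
        (Φ x).1 = Sum.inr l ∧ c x = k ∧ x.1 = Sum.inl i := by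
      intro l
      obtain ⟨⟨v, y⟩, h1, h2⟩ := hcol (Sum.inr l) k
      rcases v with i | j
      · exact ⟨_, i, h1, h2, rfl⟩
      · have := hΦ (Sum.inr (j, y))
        simp only [p, q, Sum.elim_inr] at this
        rw [this] at h1
        simp at h1
    choose x i hx1 hx2 hx3 using hx
    have hinj : Function.Injective
        (Sum.elim (fun e : M k => e.1.1) i : M k ⊕ Fin (m - d) → Fin m) := by
      have hne : ∀ (e : M k) l, e.1.1 ≠ i l := by
        intro e l hel
        obtain ⟨h1, h2⟩ := (hM k e).1 e.2
        have := hcc _ (Finset.mem_univ (p (Sum.inl ⟨e, h1⟩))) _ (Finset.mem_univ (x l))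
          (h2.trans (hx2 l).symm) (Or.inl (by rw [hpfst, hx3, hel]))
        have h3 := hx1 l
        rw [← this, hpsnd] at h3
        simp at h3
      rintro (e | l) (e' | l') hee <;> simp only [Sum.elim_inl, Sum.elim_inr] at hee
      · rw [Subtype.ext (hmatch k e e.2 e' e'.2 (Or.inl hee))]
      · exact absurd hee (hne e l')
      · exact absurd hee.symm (hne e' l)
      · have := hcc _ (Finset.mem_univ (x l)) _ (Finset.mem_univ (x l'))
          ((hx2 l).trans (hx2 l').symm) (Or.inl (by rw [hx3, hx3, hee]))
        have h3 := hx1 l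
        rw [this, hx1] at h3
        rw [Sum.inr.inj h3]
    have := Fintype.card_le_of_injective _ hinj
    simp only [Fintype.card_sum, Fintype.card_coe, Fintype.card_fin] at this
    omega

/-! ### Sub-exponential random variables -/

/-- The exponential moment `E exp (|Y| / K)` is at most `2`. -/
structure SubExp {Ω : Type*} [MeasurableSpace Ω] (Y : Ω → ℝ) (K : ℝ) (μ : Measure Ω) : Prop where
  measurable : Measurable Y
  integrable : Integrable (fun ω => Real.exp (|Y ω| / K)) μ
  le_two : ∫ ω, Real.exp (|Y ω| / K) ∂μ ≤ 2

section SubExp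

variable {Ω : Type*} [MeasurableSpace Ω] {μ : Measure Ω}

theorem SubExp.of_abs_le {Y Z : Ω → ℝ} {K : ℝ} (hK : 0 < K) (hZ : SubExp Z K μ) (hY : Measurable Y)
    (h : ∀ ω, |Y ω| ≤ |Z ω|) : SubExp Y K μ := by
  have hle : ∀ ω, Real.exp (|Y ω| / K) ≤ Real.exp (|Z ω| / K) := fun ω =>
    Real.exp_le_exp.2 (div_le_div_of_nonneg_right (h ω) hK.le)
  have hint : Integrable (fun ω => Real.exp (|Y ω| / K)) μ :=
    hZ.integrable.mono' (by fun_prop) (Filter.Eventually.of_forall fun ω => by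
      rw [Real.norm_eq_abs, Real.abs_exp]; exact hle ω)
  exact ⟨hY, hint, (integral_mono hint hZ.integrable hle).trans hZ.le_two⟩

/-- The product of two random variables with sub-exponential squares is sub-exponential. -/
theorem SubExp.mul {P Q : Ω → ℝ} {K : ℝ} (hK : 0 < K) (hPm : Measurable P) (hQm : Measurable Q)
    (hP : SubExp (fun ω => P ω ^ 2) K μ) (hQ : SubExp (fun ω => Q ω ^ 2) K μ) :
    SubExp (fun ω => P ω * Q ω) K μ := by
  have hle : ∀ ω, Real.exp (|P ω * Q ω| / K) ≤
      (1 / 2) * Real.exp (|P ω ^ 2| / K) + (1 / 2) * Real.exp (|Q ω ^ 2| / K) := by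
    intro ω
    have h1 : |P ω * Q ω| / K ≤ (1 / 2) * (|P ω ^ 2| / K) + (1 / 2) * (|Q ω ^ 2| / K) := by
      rw [abs_mul, abs_pow, abs_pow]
      have : |P ω| * |Q ω| ≤ (1 / 2) * |P ω| ^ 2 + (1 / 2) * |Q ω| ^ 2 := by
        nlinarith [sq_nonneg (|P ω| - |Q ω|)]
      calc _ ≤ ((1 / 2) * |P ω| ^ 2 + (1 / 2) * |Q ω| ^ 2) / K :=
            div_le_div_of_nonneg_right this hK.le
        _ = _ := by ring
    refine (Real.exp_le_exp.2 h1).trans ?_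
    have := convexOn_exp.2 (Set.mem_univ (|P ω ^ 2| / K)) (Set.mem_univ (|Q ω ^ 2| / K))
      (by norm_num : (0 : ℝ) ≤ 1 / 2) (by norm_num : (0 : ℝ) ≤ 1 / 2) (by norm_num)
    simpa using this
  have hsum := (hP.integrable.const_mul (1 / 2)).add (hQ.integrable.const_mul (1 / 2))
  have hint : Integrable (fun ω => Real.exp (|P ω * Q ω| / K)) μ :=
    hsum.mono' (by fun_prop) (Filter.Eventually.of_forall fun ω => by
      rw [Real.norm_eq_abs, Real.abs_exp]; exact hle ω)
  refine ⟨hPm.mul hQm, hint, (integral_mono hint hsum hle).trans ?_⟩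
  simp only [Pi.add_apply]
  rw [integral_add (hP.integrable.const_mul _) (hQ.integrable.const_mul _), integral_const_mul,
    integral_const_mul]
  linarith [hP.le_two, hQ.le_two]

theorem SubExp.integrable_self {Y : Ω → ℝ} {K : ℝ} (hK : 0 < K) (hY : SubExp Y K μ) :
    Integrable Y μ := by
  refine (hY.integrable.const_mul K).mono' hY.measurable.aestronglyMeasurable
    (Filter.Eventually.of_forall fun ω => ?_)
  have := Real.add_one_le_exp (|Y ω| / K)
  have h2 : |Y ω| / K ≤ Real.exp (|Y ω| / K) := by linarith
  rwa [div_le_iff₀ hK, mul_comm] at h2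

theorem SubExp.abs_integral_le [IsProbabilityMeasure μ] {Y : Ω → ℝ} {K : ℝ} (hK : 0 < K)
    (hY : SubExp Y K μ) : |∫ ω, Y ω ∂μ| ≤ K := by
  have h1 : ∫ ω, |Y ω| ∂μ ≤ ∫ ω, K * (Real.exp (|Y ω| / K) - 1) ∂μ := by
    refine integral_mono (hY.integrable_self hK).abs
      ((hY.integrable.sub (integrable_const 1)).const_mul K) fun ω => ?_
    have := Real.add_one_le_exp (|Y ω| / K)
    have h2 : |Y ω| / K ≤ Real.exp (|Y ω| / K) - 1 := by linarith
    rwa [div_le_iff₀ hK, mul_comm] at h2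
  have h2 : ∫ ω, K * (Real.exp (|Y ω| / K) - 1) ∂μ ≤ K := by
    rw [integral_const_mul, integral_sub hY.integrable (integrable_const 1)]
    simp only [integral_const, probReal_univ, smul_eq_mul, mul_one]
    nlinarith [hY.le_two]
  exact abs_integral_le_integral_abs.trans (h1.trans h2)

theorem SubExp.neg {Y : Ω → ℝ} {K : ℝ} (hY : SubExp Y K μ) : SubExp (fun ω => -Y ω) K μ :=
  ⟨hY.measurable.neg, by simpa using hY.integrable, by simpa using hY.le_two⟩

/-- Taylor's bound e^x ≤ 1 + x + x² e^|x|. The restriction on s spends only half of the exponent |y|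
/ K on e^|sy|; the other half absorbs y², because t² / 2 ≤ e^t for t = |y| / (2K). -/
theorem exp_le_quadratic {K s y : ℝ} (hK : 0 < K) (hs : |s| ≤ 1 / (2 * K)) :
    Real.exp (s * y) ≤ 1 + s * y + 8 * K ^ 2 * s ^ 2 * Real.exp (|y| / K) := by
  have hx : ∀ x : ℝ, Real.exp x ≤ 1 + x + x ^ 2 * Real.exp |x| := by
    intro x
    have h := Complex.norm_exp_sub_sum_le_norm_mul_exp (x : ℂ) 2
    simp only [Finset.sum_range_succ, Finset.sum_range_zero, pow_zero, Nat.factorial_zero,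
      Nat.cast_one, div_one, zero_add, pow_one, Nat.factorial_one, Complex.norm_real,
      Real.norm_eq_abs, sq_abs] at h
    have h2 : ‖Complex.exp (x : ℂ) - (1 + x)‖ = |Real.exp x - (1 + x)| := by
      rw [← Real.norm_eq_abs, ← Complex.norm_real]; push_cast; rfl
    rw [h2] at h
    linarith [le_abs_self (Real.exp x - (1 + x))]
  have h1 : |s * y| ≤ |y| / (2 * K) := by
    rw [abs_mul]
    calc |s| * |y| ≤ 1 / (2 * K) * |y| := mul_le_mul_of_nonneg_right hs (abs_nonneg _)
      _ = _ := by ring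
  set t := |y| / (2 * K) with ht
  have ht0 : 0 ≤ t := by positivity
  have h2 : t ^ 2 / 2 ≤ Real.exp t := by
    have := Real.quadratic_le_exp_of_nonneg ht0
    linarith
  have hy : y ^ 2 = 4 * K ^ 2 * t ^ 2 := by
    rw [ht, div_pow, sq_abs]; field_simp; ring
  have he : Real.exp (|y| / K) = Real.exp t * Real.exp t := by
    rw [← Real.exp_add]; congr 1; rw [ht]; field_simp; ring
  calc Real.exp (s * y) ≤ 1 + s * y + (s * y) ^ 2 * Real.exp |s * y| := hx _
    _ ≤ 1 + s * y + (s * y) ^ 2 * Real.exp t := by gcongr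
    _ = 1 + s * y + 8 * K ^ 2 * s ^ 2 * (t ^ 2 / 2 * Real.exp t) := by rw [mul_pow, hy]; ring
    _ ≤ 1 + s * y + 8 * K ^ 2 * s ^ 2 * (Real.exp t * Real.exp t) := by gcongr
    _ = _ := by rw [he]

theorem SubExp.integrable_exp_mul {Y : Ω → ℝ} {K s : ℝ} (hK : 0 < K)
    (hY : SubExp Y K μ) (hs : |s| ≤ 1 / (2 * K)) : Integrable (fun ω => Real.exp (s * Y ω)) μ := by
  refine hY.integrable.mono' (by have := hY.measurable; fun_prop)
    (Filter.Eventually.of_forall fun ω => ?_)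
  rw [Real.norm_eq_abs, Real.abs_exp, Real.exp_le_exp]
  calc s * Y ω ≤ |s| * |Y ω| := by rw [← abs_mul]; exact le_abs_self _
    _ ≤ 1 / (2 * K) * |Y ω| := mul_le_mul_of_nonneg_right hs (abs_nonneg _)
    _ = |Y ω| / K / 2 := by field_simp
    _ ≤ _ := half_le_self (by positivity)

/-- The mean stays in the exponent, so squares and products enter Bernstein's inequality without
being centred. -/
theorem SubExp.mgf_le [IsProbabilityMeasure μ] {Y : Ω → ℝ} {K s : ℝ} (hK : 0 < K)
    (hY : SubExp Y K μ) (hs : |s| ≤ 1 / (2 * K)) :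
    mgf Y μ s ≤ Real.exp (s * ∫ ω, Y ω ∂μ + 16 * K ^ 2 * s ^ 2) := by
  have hYi := hY.integrable_self hK
  have h1 : Integrable (fun ω => 1 + s * Y ω) μ := (integrable_const 1).add (hYi.const_mul s)
  have h2 : Integrable (fun ω => 8 * K ^ 2 * s ^ 2 * Real.exp (|Y ω| / K)) μ :=
    hY.integrable.const_mul _
  calc mgf Y μ s ≤ ∫ ω, (1 + s * Y ω) + 8 * K ^ 2 * s ^ 2 * Real.exp (|Y ω| / K) ∂μ :=
        integral_mono (hY.integrable_exp_mul hK hs) (h1.add h2) fun ω => exp_le_quadratic hK hs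
    _ = 1 + s * ∫ ω, Y ω ∂μ + 8 * K ^ 2 * s ^ 2 * ∫ ω, Real.exp (|Y ω| / K) ∂μ := by
        rw [integral_add h1 h2, integral_add (integrable_const 1) (hYi.const_mul s),
          integral_const_mul, integral_const_mul]
        simp
    _ ≤ 1 + s * ∫ ω, Y ω ∂μ + 8 * K ^ 2 * s ^ 2 * 2 := by
        have := hY.le_two
        gcongr
    _ ≤ _ := by
        have := Real.add_one_le_exp (s * ∫ ω, Y ω ∂μ + 16 * K ^ 2 * s ^ 2)
        linarith

theorem SubExp.measureReal_sum_ge_le [IsProbabilityMeasure μ] {ι : Type*} {Y : ι → Ω → ℝ} {K : ℝ}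
    (hK : 0 < K) (hY : ∀ i, SubExp (Y i) K μ) (hind : iIndepFun Y μ) (s : Finset ι) {N : ℕ}
    (hs : s.card ≤ N) {t : ℝ} (ht : 0 < t) (htK : t ≤ 16 * K) :
    μ.real {ω | t * N ≤ ∑ i ∈ s, Y i ω - ∑ i ∈ s, ∫ ω, Y i ω ∂μ} ≤
      Real.exp (-(N * (t ^ 2 / (64 * K ^ 2)))) := by
  -- The minimiser of -l t + 16 K² l². The assumption t ≤ 16 K is exactly what keeps it in the range
  -- |l| ≤ 1 / (2K).
  set l := t / (32 * K ^ 2) with hl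
  have hl0 : 0 < l := by positivity
  have hlK : |l| ≤ 1 / (2 * K) := by
    rw [abs_of_pos hl0, hl, div_le_div_iff₀ (by positivity) (by positivity)]
    nlinarith
  have hmeas : ∀ i, Measurable (Y i) := fun i => (hY i).measurable
  set S := ∑ i ∈ s, Y i with hS
  have hSint : Integrable (fun ω => Real.exp (l * S ω)) μ :=
    hind.integrable_exp_mul_sum hmeas fun i _ => (hY i).integrable_exp_mul hK hlK
  have hset : {ω | t * N ≤ ∑ i ∈ s, Y i ω - ∑ i ∈ s, ∫ ω, Y i ω ∂μ} =
      {ω | t * N + ∑ i ∈ s, ∫ ω, Y i ω ∂μ ≤ S ω} := by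
    ext ω
    simp only [Set.mem_ofPred_eq, hS, Finset.sum_apply]
    constructor <;> intro h <;> linarith
  rw [hset]
  refine (measure_ge_le_exp_mul_mgf _ hl0.le hSint).trans ?_
  rw [hind.mgf_sum hmeas]
  have hprod : ∏ i ∈ s, mgf (Y i) μ l ≤
      Real.exp (l * ∑ i ∈ s, ∫ ω, Y i ω ∂μ + N * (16 * K ^ 2 * l ^ 2)) := by
    calc ∏ i ∈ s, mgf (Y i) μ l
        ≤ ∏ i ∈ s, Real.exp (l * ∫ ω, Y i ω ∂μ + 16 * K ^ 2 * l ^ 2) :=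
          Finset.prod_le_prod (fun i _ => mgf_nonneg) fun i _ => (hY i).mgf_le hK hlK
      _ = Real.exp (l * ∑ i ∈ s, ∫ ω, Y i ω ∂μ + s.card * (16 * K ^ 2 * l ^ 2)) := by
          rw [← Real.exp_sum, Finset.sum_add_distrib, ← Finset.mul_sum, Finset.sum_const,
            nsmul_eq_mul]
      _ ≤ _ := by
          have : (s.card : ℝ) ≤ N := by exact_mod_cast hs
          gcongr
  refine (mul_le_mul_of_nonneg_left hprod (Real.exp_pos _).le).trans ?_
  rw [← Real.exp_add, Real.exp_le_exp, hl]
  apply le_of_eq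
  field_simp
  ring

/-- **Bernstein's inequality** for sums of at most `N` independent sub-exponential variables. -/
theorem SubExp.measureReal_abs_sum_ge_le [IsProbabilityMeasure μ] {ι : Type*} {Y : ι → Ω → ℝ}
    {K : ℝ} (hK : 0 < K) (hY : ∀ i, SubExp (Y i) K μ) (hind : iIndepFun Y μ) (s : Finset ι) {N : ℕ}
    (hs : s.card ≤ N) {t : ℝ} (ht : 0 < t) (htK : t ≤ 16 * K) :
    μ.real {ω | t * N ≤ |∑ i ∈ s, Y i ω - ∑ i ∈ s, ∫ ω, Y i ω ∂μ|} ≤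
      2 * Real.exp (-(N * (t ^ 2 / (64 * K ^ 2)))) := by
  have h1 := SubExp.measureReal_sum_ge_le hK hY hind s hs ht htK
  have h2 := SubExp.measureReal_sum_ge_le hK (fun i => (hY i).neg)
    (hind.comp (fun _ x => -x) fun _ => measurable_neg) s hs ht htK
  have hsub : {ω | t * N ≤ |∑ i ∈ s, Y i ω - ∑ i ∈ s, ∫ ω, Y i ω ∂μ|} ⊆
      {ω | t * N ≤ ∑ i ∈ s, Y i ω - ∑ i ∈ s, ∫ ω, Y i ω ∂μ} ∪
      {ω | t * N ≤ ∑ i ∈ s, -Y i ω - ∑ i ∈ s, ∫ ω, -Y i ω ∂μ} := by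
    intro ω hω
    rcases le_abs.1 (Set.mem_ofPred_eq ▸ hω : _ ≤ |_|) with h | h
    · exact Or.inl h
    · right
      simp only [Set.mem_ofPred_eq, integral_neg, Finset.sum_neg_distrib]
      linarith
  refine (measureReal_mono hsub).trans ((measureReal_union_le _ _).trans ?_)
  linarith

/-! ### Squares of sub-Gaussian random variables -/

theorem lintegral_exp_sq_gaussian_le :
    ∫⁻ x, ENNReal.ofReal (Real.exp (x ^ 2 / 4)) ∂(gaussianReal 0 1) ≤ 2 := by
  rw [gaussianReal_of_var_ne_zero _ one_ne_zero,
    lintegral_withDensity_eq_lintegral_mul _ (measurable_gaussianPDF _ _) (by fun_prop)]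
  have h : ∀ x : ℝ, (gaussianPDF 0 1 * fun x => ENNReal.ofReal (Real.exp (x ^ 2 / 4))) x =
      ENNReal.ofReal ((√(2 * Real.pi))⁻¹ * Real.exp (-(1 / 4) * x ^ 2)) := by
    intro x
    simp only [Pi.mul_apply, gaussianPDF, gaussianPDFReal_def]
    rw [← ENNReal.ofReal_mul (by positivity), mul_assoc, ← Real.exp_add]
    congr 2
    · simp
    · congr 1; simp; ring
  simp_rw [h]
  rw [← ofReal_integral_eq_lintegral_ofReal
    ((integrable_exp_neg_mul_sq (by norm_num)).const_mul _)
    (Filter.Eventually.of_forall fun x => by positivity), integral_const_mul, integral_gaussian]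
  have h2 : (√(2 * Real.pi))⁻¹ * √(Real.pi / (1 / 4)) ≤ 2 := by
    rw [inv_mul_le_iff₀ (by positivity)]
    have : (2 : ℝ) = √4 := by rw [show (4 : ℝ) = 2 ^ 2 by norm_num, Real.sqrt_sq (by norm_num)]
    rw [mul_comm, this, ← Real.sqrt_mul (by norm_num)]
    refine Real.sqrt_le_sqrt ?_
    rw [← this]
    nlinarith [Real.pi_pos]
  calc _ ≤ ENNReal.ofReal 2 := ENNReal.ofReal_le_ofReal h2
    _ = 2 := by simp

/-- Linearisation by an auxiliary standard Gaussian g: exp (P² / (4σ)) is the mean over g of exp (P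
g / √(2σ)). After exchanging the integrals, the sub-Gaussian bound at g / √(2σ) leaves the mean of
exp (g² / 4), which is √2. -/
theorem subExp_sq_of_hasSubgaussianMGF [IsProbabilityMeasure μ] {P : Ω → ℝ} {c : NNReal} {σ : ℝ}
    (hσ : 0 < σ) (hc : c ≤ σ) (hPm : Measurable P) (hP : HasSubgaussianMGF P c μ) :
    SubExp (fun ω => P ω ^ 2) (4 * σ) μ := by
  set r := √(2 * σ) with hr
  have hr2 : r ^ 2 = 2 * σ := Real.sq_sqrt (by positivity)
  have hr0 : 0 < r := Real.sqrt_pos.2 (by positivity)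
  have h1 : ∀ ω, ENNReal.ofReal (Real.exp (|P ω ^ 2| / (4 * σ))) =
      ∫⁻ g, ENNReal.ofReal (Real.exp (P ω / r * g)) ∂(gaussianReal 0 1) := by
    intro ω
    have h := congrFun (mgf_fun_id_gaussianReal (μ := 0) (v := 1)) (P ω / r)
    rw [← ofReal_integral_eq_lintegral_ofReal]
    · rw [mgf] at h
      rw [h]
      congr 2
      simp only [abs_pow, sq_abs, NNReal.coe_one, zero_mul, zero_add, one_mul]
      rw [div_pow, hr2]
      field_simp
      norm_num
    · exact integrable_exp_mul_gaussianReal _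
    · exact Filter.Eventually.of_forall fun x => (Real.exp_pos _).le
  have h2 : ∫⁻ ω, ENNReal.ofReal (Real.exp (|P ω ^ 2| / (4 * σ))) ∂μ ≤ 2 := by
    simp_rw [h1]
    rw [lintegral_lintegral_swap (by fun_prop)]
    refine le_trans (lintegral_mono fun g => ?_) lintegral_exp_sq_gaussian_le
    have h := hP.mgf_le (g / r)
    have h3 : ∫⁻ ω, ENNReal.ofReal (Real.exp (P ω / r * g)) ∂μ =
        ENNReal.ofReal (mgf P μ (g / r)) := by
      rw [mgf, ofReal_integral_eq_lintegral_ofReal (hP.integrable_exp_mul _)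
        (Filter.Eventually.of_forall fun x => (Real.exp_pos _).le)]
      refine lintegral_congr fun ω => ?_
      congr 2; ring
    rw [h3]
    refine ENNReal.ofReal_le_ofReal (h.trans (Real.exp_le_exp.2 ?_))
    rw [div_pow, hr2]
    calc c * (g ^ 2 / (2 * σ)) / 2 ≤ σ * (g ^ 2 / (2 * σ)) / 2 := by gcongr
      _ = g ^ 2 / 4 := by field_simp; norm_num
  have hint : Integrable (fun ω => Real.exp (|P ω ^ 2| / (4 * σ))) μ := by
    refine ⟨by fun_prop, ?_⟩
    rw [hasFiniteIntegral_iff_ofReal (Filter.Eventually.of_forall fun x => (Real.exp_pos _).le)]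
    exact h2.trans_lt (by simp)
  refine ⟨by fun_prop, hint, ?_⟩
  rw [integral_eq_lintegral_of_nonneg_ae
    (Filter.Eventually.of_forall fun x => (Real.exp_pos _).le) hint.aestronglyMeasurable]
  exact ENNReal.toReal_le_of_le_ofReal (by norm_num) (by simpa using h2)

/-! ### Independent blocks and conditioning on coordinates -/

theorem iIndepFun_of_disjoint_blocks {ι κ E : Type*} [MeasurableSpace E] {X : ι → Ω → E}
    (hX : iIndepFun X μ) (hm : ∀ i, Measurable (X i)) (S : κ → Finset ι)
    (hS : Pairwise fun k l => Disjoint (S k) (S l)) :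
    iIndepFun (fun k ω (i : S k) => X i ω) μ := by
  classical
  have := hX.isProbabilityMeasure
  rw [iIndepFun_iff_measure_inter_preimage_eq_mul]
  intro T B hB
  induction T using Finset.induction_on with
  | empty => simp
  | insert k T hk ih =>
    have hB' : ∀ l ∈ T, MeasurableSet (B l) := fun l hl => hB l (Finset.mem_insert_of_mem hl)
    set U := T.biUnion S with hU
    have hmem : ∀ l (hl : l ∈ T) (i : S l), (i : ι) ∈ U := fun l hl i =>
      Finset.mem_biUnion.2 ⟨l, hl, i.2⟩
    let C : Set (U → E) :=
      ⋂ l : T, (fun f (i : S l.1) => f ⟨i, hmem l.1 l.2 i⟩) ⁻¹' B l.1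
    have hC : MeasurableSet C := by
      refine MeasurableSet.iInter fun l => ?_
      exact measurableSet_preimage (by fun_prop) (hB' l.1 l.2)
    have hpre : (⋂ l ∈ T, (fun ω (i : S l) => X i ω) ⁻¹' B l) = (fun ω (i : U) => X i ω) ⁻¹' C := by
      ext ω; simp [C]
    have hdisj : Disjoint (S k) U := by
      rw [hU, Finset.disjoint_biUnion_right]
      exact fun l hl => hS (fun h => hk (h ▸ hl))
    rw [Finset.set_biInter_insert, Finset.prod_insert hk, ← ih hB', hpre]
    exact (hX.indepFun_finset (S k) U hdisj hm).measure_inter_preimage_eq_mul _ _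
      (hB k (Finset.mem_insert_self _ _)) hC

end SubExp

/-- Gluing two independent copies along `S` gives back the product law. Freezing the first copy is
conditioning on the coordinates in `S` without conditional expectations. -/
theorem measurePreserving_piecewise {ι E : Type*} [Fintype ι] [MeasurableSpace E]
    (ν : Measure E) [IsProbabilityMeasure ν] (S : Finset ι) [∀ i, Decidable (i ∈ S)] :
    MeasurePreserving (fun z : (ι → E) × (ι → E) => fun i => if i ∈ S then z.1 i else z.2 i)
      ((Measure.pi fun _ => ν).prod (Measure.pi fun _ => ν)) (Measure.pi fun _ => ν) := by
  have hm : Measurable (fun z : (ι → E) × (ι → E) => fun i => if i ∈ S then z.1 i else z.2 i) := by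
    refine measurable_pi_lambda _ fun i => ?_
    split_ifs <;> fun_prop
  refine ⟨hm, (Measure.pi_eq fun s hs => ?_).symm⟩
  have hpre : (fun z : (ι → E) × (ι → E) => fun i => if i ∈ S then z.1 i else z.2 i) ⁻¹'
      Set.pi Set.univ s =
      (Set.pi Set.univ fun i => if i ∈ S then s i else Set.univ) ×ˢ
      (Set.pi Set.univ fun i => if i ∈ S then Set.univ else s i) := by
    ext z
    simp only [Set.mem_preimage, Set.mem_pi, Set.mem_univ, true_implies, Set.mem_prod,
      ← forall_and]
    refine forall_congr' fun i => ?_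
    by_cases hi : i ∈ S <;> simp [hi]
  rw [Measure.map_apply hm (MeasurableSet.univ_pi hs), hpre, Measure.prod_prod, Measure.pi_pi,
    Measure.pi_pi, ← Finset.prod_mul_distrib]
  refine Finset.prod_congr rfl fun i _ => ?_
  by_cases hi : i ∈ S <;> simp [hi]

/-- A bound that holds for every first coordinate holds for the product measure. -/
theorem prod_measureReal_le_of_forall {Ω₁ Ω₂ : Type*} [MeasurableSpace Ω₁] [MeasurableSpace Ω₂]
    (μ₁ : Measure Ω₁) (μ₂ : Measure Ω₂) [IsProbabilityMeasure μ₁] [IsProbabilityMeasure μ₂]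
    {A : Set (Ω₁ × Ω₂)} (hA : MeasurableSet A) {p : ℝ} (hp : 0 ≤ p)
    (h : ∀ x, μ₂.real {y | (x, y) ∈ A} ≤ p) : (μ₁.prod μ₂).real A ≤ p := by
  refine ENNReal.toReal_le_of_le_ofReal hp ?_
  rw [Measure.prod_apply hA]
  calc _ ≤ ∫⁻ _, ENNReal.ofReal p ∂μ₁ := lintegral_mono fun x => by
        rw [← ofReal_measureReal]
        exact ENNReal.ofReal_le_ofReal (h x)
    _ = _ := by simp

/-- A bound that holds conditionally on the coordinates in `S` holds unconditionally. -/
theorem pi_measureReal_le_of_forall_piecewise {ι E : Type*} [Fintype ι] [MeasurableSpace E]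
    (ν : Measure E) [IsProbabilityMeasure ν] (S : Finset ι) [∀ i, Decidable (i ∈ S)]
    {A : Set (ι → E)} (hA : MeasurableSet A) {p : ℝ} (hp : 0 ≤ p)
    (h : ∀ z : ι → E,
      (Measure.pi fun _ => ν).real {z' | (fun i => if i ∈ S then z i else z' i) ∈ A} ≤ p) :
    (Measure.pi fun _ => ν).real A ≤ p := by
  have hmp := measurePreserving_piecewise ν S
  rw [← hmp.measureReal_preimage hA.nullMeasurableSet]
  exact prod_measureReal_le_of_forall _ _ (hmp.measurable hA) hp h

/-! ### Capped directions of Gaussian vectors -/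

/-- The law of one row of the Gaussian embedding. -/
noncomputable abbrev rowLaw (d : ℕ) : Measure (Fin d → ℝ) := Measure.pi fun _ => gaussianReal 0 ((d : NNReal)⁻¹)

open Classical in
/-- The direction `z / ‖z‖` of a vector whose norm is at least one half, and `0` for shorter
vectors. -/
noncomputable def cappedDir {d : ℕ} (z : Fin d → ℝ) : Fin d → ℝ :=
  if 1 / 4 ≤ ∑ b, z b ^ 2 then fun a => z a / √(∑ b, z b ^ 2) else 0

theorem measurable_cappedDir {d : ℕ} : Measurable (cappedDir (d := d)) := by
  unfold cappedDir
  refine Measurable.ite (measurableSet_le (by fun_prop) (by fun_prop)) ?_ measurable_const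
  fun_prop

theorem measurable_cappedDir_apply {d : ℕ} (k : Fin d) :
    Measurable fun z : Fin d → ℝ => cappedDir z k :=
  (measurable_pi_apply k).comp measurable_cappedDir

theorem measurable_dot_cappedDir {d : ℕ} (u : Fin d → ℝ) :
    Measurable fun z : Fin d → ℝ => u ⬝ᵥ cappedDir z := by
  unfold dotProduct
  exact Finset.measurable_sum _ fun k _ => (measurable_cappedDir_apply k).const_mul _

theorem sum_cappedDir_sq_le {d : ℕ} (z : Fin d → ℝ) : ∑ k, cappedDir z k ^ 2 ≤ 1 := by
  unfold cappedDir
  split_ifs with h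
  · have h0 : 0 < ∑ b, z b ^ 2 := by linarith
    simp only [div_pow, Real.sq_sqrt h0.le, ← Finset.sum_div]
    rw [div_self h0.ne']
  · simp

theorem sum_cappedDir_sq_eq {d : ℕ} {z : Fin d → ℝ} (h : 1 / 4 ≤ ∑ b, z b ^ 2) :
    ∑ k, cappedDir z k ^ 2 = 1 := by
  have h0 : 0 < ∑ b, z b ^ 2 := by linarith
  simp only [cappedDir, if_pos h, div_pow, Real.sq_sqrt h0.le, ← Finset.sum_div]
  rw [div_self h0.ne']

theorem abs_cappedDir_le_one {d : ℕ} (z : Fin d → ℝ) (k : Fin d) : |cappedDir z k| ≤ 1 := by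
  rw [← sq_le_one_iff_abs_le_one]
  exact (Finset.single_le_sum (f := fun k => cappedDir z k ^ 2) (fun i _ => sq_nonneg _)
    (Finset.mem_univ k)).trans (sum_cappedDir_sq_le z)

/-- The purpose of the cap: where the direction is not 0 the norm is at least 1/2, so linear forms
of the direction are dominated pointwise by those of the Gaussian vector and inherit their tails. -/
theorem abs_dot_cappedDir_le {d : ℕ} (u z : Fin d → ℝ) : |u ⬝ᵥ cappedDir z| ≤ 2 * |u ⬝ᵥ z| := by
  unfold cappedDir
  split_ifs with h
  · have hs : 1 / 2 ≤ √(∑ b, z b ^ 2) := by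
      rw [show (1 / 2 : ℝ) = √(1 / 4) by
        rw [show (1 / 4 : ℝ) = (1 / 2) ^ 2 by norm_num, Real.sqrt_sq (by norm_num)]]
      exact Real.sqrt_le_sqrt h
    have : (u ⬝ᵥ fun a => z a / √(∑ b, z b ^ 2)) = (u ⬝ᵥ z) / √(∑ b, z b ^ 2) := by
      simp only [dotProduct, Finset.sum_div, mul_div_assoc]
    rw [this, abs_div, abs_of_nonneg (Real.sqrt_nonneg _), div_le_iff₀ (by linarith)]
    nlinarith [abs_nonneg (u ⬝ᵥ z)]
  · simp

/-! ### Concentration for a single row -/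

theorem hasSubgaussianMGF_gaussianReal (v : NNReal) :
    HasSubgaussianMGF (fun x => x) v (gaussianReal 0 v) := by
  refine ⟨fun t => integrable_exp_mul_gaussianReal _, fun t => ?_⟩
  rw [mgf_fun_id_gaussianReal]
  simp

/-- Linear combinations of independent sub-Gaussian coordinates are sub-Gaussian. -/
theorem hasSubgaussianMGF_dot {n : ℕ} {ν : Measure ℝ} [IsProbabilityMeasure ν] {c : NNReal}
    (hν : HasSubgaussianMGF (fun x => x) c ν) (u : Fin n → ℝ) :
    ∃ c' : NNReal, (c' : ℝ) = c * ∑ k, u k ^ 2 ∧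
      HasSubgaussianMGF (fun z => u ⬝ᵥ z) c' (Measure.pi fun _ : Fin n => ν) := by
  have h1 : ∀ k : Fin n, HasSubgaussianMGF (fun z : Fin n → ℝ => u k * z k)
      (⟨u k ^ 2, sq_nonneg _⟩ * c) (Measure.pi fun _ : Fin n => ν) := by
    intro k
    refine HasSubgaussianMGF.const_mul ?_ (u k)
    have hmp := measurePreserving_eval (fun _ : Fin n => ν) k
    exact HasSubgaussianMGF.of_map (X := fun x => x) hmp.aemeasurable (by rw [hmp.map_eq]; exact hν)
  have hind : iIndepFun (fun (k : Fin n) (z : Fin n → ℝ) => u k * z k)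
      (Measure.pi fun _ : Fin n => ν) :=
    iIndepFun_pi (μ := fun _ : Fin n => ν) (X := fun k x => u k * x) fun k => by fun_prop
  refine ⟨_, ?_, HasSubgaussianMGF.sum_of_iIndepFun hind (s := Finset.univ) fun k _ => h1 k⟩
  push_cast
  rw [Finset.mul_sum]
  exact Finset.sum_congr rfl fun k _ => mul_comm _ _

/-- The probability bound that all the estimates below meet. -/
noncomputable def tailBound (d : ℕ) : ℝ := 2 * Real.exp (-(d / 2 ^ 26))

theorem tailBound_nonneg (d : ℕ) : 0 ≤ tailBound d := by unfold tailBound; positivity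

/-- The rate 2⁻²⁶ is the smallest value of t² / (64 K²) that is needed: it is attained with t = 1/64
and K = 16 in `measureReal_bilinear_le`. -/
theorem two_mul_exp_le_tailBound (d : ℕ) {c : ℝ} (hc : 1 / 2 ^ 26 ≤ c) :
    2 * Real.exp (-(d * c)) ≤ tailBound d := by
  unfold tailBound
  have : (d : ℝ) / 2 ^ 26 ≤ d * c := by
    rw [div_eq_mul_one_div]; gcongr
  gcongr

theorem subExp_dot_sq {d : ℕ} (hd : 0 < d) {u : Fin d → ℝ} (hu : ∑ k, u k ^ 2 ≤ 1) :
    SubExp (fun z => (√d * (u ⬝ᵥ z)) ^ 2) 4 (rowLaw d) := by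
  have hd' : (0 : ℝ) < d := by exact_mod_cast hd
  obtain ⟨c, hc, hsg⟩ := hasSubgaussianMGF_dot
    (hasSubgaussianMGF_gaussianReal ((d : NNReal)⁻¹)) u
  have h2 := hsg.const_mul (√d)
  have := subExp_sq_of_hasSubgaussianMGF (σ := 1) one_pos ?_ ?_ h2
  · simpa using this
  · change √(d : ℝ) ^ 2 * (c : ℝ) ≤ 1
    rw [hc, Real.sq_sqrt hd'.le]
    push_cast
    rw [← mul_assoc, mul_inv_cancel₀ hd'.ne', one_mul]
    exact hu
  · unfold dotProduct; fun_prop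

/-- The factor 2 lost by capping becomes 4 after squaring, which turns the constant 4 of the
Gaussian vector into 16. -/
theorem subExp_dot_cappedDir_sq {d : ℕ} (hd : 0 < d) {u : Fin d → ℝ} (hu : ∑ k, u k ^ 2 ≤ 1) :
    SubExp (fun z => (√d * (u ⬝ᵥ cappedDir z)) ^ 2) 16 (rowLaw d) := by
  have h := subExp_dot_sq hd hu
  have h4 : SubExp (fun z => 4 * (√d * (u ⬝ᵥ z)) ^ 2) 16 (rowLaw d) := by
    refine ⟨h.measurable.const_mul 4, ?_, ?_⟩
    · convert! h.integrable using 3 with z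
      rw [abs_mul, abs_of_pos (by norm_num : (0 : ℝ) < 4)]; ring
    · convert! h.le_two using 4 with z
      rw [abs_mul, abs_of_pos (by norm_num : (0 : ℝ) < 4)]; ring
  refine h4.of_abs_le (by norm_num) (((measurable_dot_cappedDir u).const_mul _).pow_const 2)
    fun z => ?_
  rw [abs_of_nonneg (sq_nonneg _), abs_of_nonneg (by positivity), mul_pow, mul_pow,
    ← sq_abs (u ⬝ᵥ cappedDir z), ← sq_abs (u ⬝ᵥ z)]
  have := abs_dot_cappedDir_le u z
  have h5 : |u ⬝ᵥ cappedDir z| ^ 2 ≤ (2 * |u ⬝ᵥ z|) ^ 2 := by gcongr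
  calc √d ^ 2 * |u ⬝ᵥ cappedDir z| ^ 2 ≤ √d ^ 2 * (2 * |u ⬝ᵥ z|) ^ 2 := by gcongr
    _ = _ := by ring

theorem measureReal_short_le {d : ℕ} (hd : 0 < d) :
    (rowLaw d).real {z | ∑ b, z b ^ 2 < 1 / 4} ≤ tailBound d := by
  have hd' : (0 : ℝ) < d := by exact_mod_cast hd
  have hY : ∀ k : Fin d, SubExp (fun z => (√d * z k) ^ 2) 4 (rowLaw d) := by
    intro k
    have h := subExp_dot_sq hd (u := Pi.single k 1) (by
      rw [Finset.sum_eq_single k (fun b _ hb => by simp [hb]) (by simp)]; simp)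
    simpa using h
  have hind : iIndepFun (fun (k : Fin d) (z : Fin d → ℝ) => (√d * z k) ^ 2) (rowLaw d) :=
    iIndepFun_pi (μ := fun _ : Fin d => gaussianReal 0 ((d : NNReal)⁻¹))
      (X := fun k x => (√d * x) ^ 2) fun k => by fun_prop
  have hmean : ∀ k : Fin d, ∫ z, (√d * z k) ^ 2 ∂(rowLaw d) = 1 := by
    intro k
    have hmp := measurePreserving_eval (fun _ : Fin d => gaussianReal 0 ((d : NNReal)⁻¹)) k
    have h1 : ∫ z, (√d * z k) ^ 2 ∂(rowLaw d) =
        ∫ x, (√d * x) ^ 2 ∂(gaussianReal 0 ((d : NNReal)⁻¹)) := by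
      rw [← hmp.map_eq, integral_map hmp.aemeasurable (by fun_prop)]
    rw [h1]
    simp only [mul_pow, Real.sq_sqrt hd'.le]
    rw [integral_const_mul]
    have h2 := variance_fun_id_gaussianReal (μ := 0) (v := (d : NNReal)⁻¹)
    rw [variance_of_integral_eq_zero (by fun_prop) integral_id_gaussianReal] at h2
    rw [h2]
    push_cast
    exact mul_inv_cancel₀ hd'.ne'
  -- The squared norm has mean 1, so falling below 1/4 is a deviation of 3/4.
  have hB := SubExp.measureReal_abs_sum_ge_le (by norm_num) hY hind Finset.univ (N := d) (by simp)
    (t := 3 / 4) (by norm_num) (by norm_num)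
  refine (measureReal_mono fun z hz => ?_).trans
    (hB.trans (two_mul_exp_le_tailBound d (by norm_num)))
  simp only [Set.mem_ofPred_eq] at hz ⊢
  simp only [hmean]
  simp only [mul_pow, Real.sq_sqrt hd'.le, ← Finset.mul_sum, Finset.sum_const,
    Finset.card_univ, Fintype.card_fin, nsmul_eq_mul, mul_one]
  refine le_trans ?_ (neg_le_abs _)
  nlinarith

theorem measureReal_dot_cappedDir_gt_le {d : ℕ} (hd : 0 < d) {u : Fin d → ℝ}
    (hu : ∑ k, u k ^ 2 ≤ 1) :
    (rowLaw d).real {z | 1 / 64 < |u ⬝ᵥ cappedDir z|} ≤ tailBound d := by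
  have hd' : (0 : ℝ) < d := by exact_mod_cast hd
  have h := subExp_dot_cappedDir_sq hd hu
  -- Markov's inequality for the exponential moment; |u ⬝ᵥ cappedDir z| > 1/64 makes the exponent at
  -- least d · 2⁻¹² / 16 = d · 2⁻¹⁶.
  have hM := mul_meas_ge_le_integral_of_nonneg
    (Filter.Eventually.of_forall fun z => (Real.exp_pos (|(√d * (u ⬝ᵥ cappedDir z)) ^ 2| / 16)).le)
    h.integrable (Real.exp (d * (1 / 2 ^ 16)))
  have h2 : (rowLaw d).real {z | 1 / 64 < |u ⬝ᵥ cappedDir z|} ≤ (rowLaw d).real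
      {z | Real.exp (d * (1 / 2 ^ 16)) ≤ Real.exp (|(√d * (u ⬝ᵥ cappedDir z)) ^ 2| / 16)} := by
    refine measureReal_mono fun z hz => ?_
    simp only [Set.mem_ofPred_eq, Real.exp_le_exp] at hz ⊢
    rw [abs_of_nonneg (sq_nonneg _), mul_pow, Real.sq_sqrt hd'.le, ← sq_abs]
    have h3 : (1 / 64 : ℝ) ^ 2 ≤ |u ⬝ᵥ cappedDir z| ^ 2 := by gcongr
    rw [mul_div_assoc]
    refine mul_le_mul_of_nonneg_left ?_ hd'.le
    linarith
  refine h2.trans (le_trans ?_ (two_mul_exp_le_tailBound d (c := 1 / 2 ^ 16) (by norm_num)))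
  rw [Real.exp_neg, ← div_eq_mul_inv, le_div_iff₀ (Real.exp_pos _), mul_comm]
  exact hM.trans h.le_two

/-! ### First and second moments of capped directions -/

theorem measurePreserving_flip (d : ℕ) (k : Fin d) :
    MeasurePreserving (fun (z : Fin d → ℝ) i => if i = k then -z i else z i)
      (rowLaw d) (rowLaw d) := by
  refine measurePreserving_pi (fun _ : Fin d => gaussianReal 0 ((d : NNReal)⁻¹))
    (fun _ : Fin d => gaussianReal 0 ((d : NNReal)⁻¹)) (f := fun i x => if i = k then -x else x)
    fun i => ?_
  by_cases h : i = k
  · simp only [h, if_true]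
    exact ⟨measurable_neg, by rw [gaussianReal_map_neg, neg_zero]⟩
  · simp only [h, if_false]
    exact MeasurePreserving.id _

theorem cappedDir_flip {d : ℕ} (k : Fin d) (z : Fin d → ℝ) :
    cappedDir (fun i => if i = k then -z i else z i) =
      fun i => if i = k then -cappedDir z i else cappedDir z i := by
  have h : ∑ b, (if b = k then -z b else z b) ^ 2 = ∑ b, z b ^ 2 :=
    Finset.sum_congr rfl fun b _ => by split_ifs <;> ring
  unfold cappedDir
  rw [h]
  by_cases hz : 1 / 4 ≤ ∑ b, z b ^ 2
  · simp only [if_pos hz]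
    ext i
    split_ifs <;> ring
  · simp only [if_neg hz]
    ext i
    simp

theorem measurePreserving_perm (d : ℕ) (σ : Equiv.Perm (Fin d)) :
    MeasurePreserving (fun (z : Fin d → ℝ) i => z (σ i)) (rowLaw d) (rowLaw d) := by
  have hm : Measurable (fun (z : Fin d → ℝ) i => z (σ i)) := by fun_prop
  refine ⟨hm, (Measure.pi_eq fun s hs => ?_).symm⟩
  have hpre : (fun (z : Fin d → ℝ) i => z (σ i)) ⁻¹' Set.pi Set.univ s =
      Set.pi Set.univ fun i => s (σ.symm i) := by
    ext z
    simp only [Set.mem_preimage, Set.mem_pi, Set.mem_univ, true_implies]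
    exact ⟨fun h i => by simpa using h (σ.symm i), fun h i => by simpa using h (σ i)⟩
  rw [Measure.map_apply hm (MeasurableSet.univ_pi hs), hpre, Measure.pi_pi]
  exact Equiv.prod_comp σ.symm fun i => gaussianReal 0 ((d : NNReal)⁻¹) (s i)

theorem cappedDir_perm {d : ℕ} (σ : Equiv.Perm (Fin d)) (z : Fin d → ℝ) :
    cappedDir (fun i => z (σ i)) = fun i => cappedDir z (σ i) := by
  have h : ∑ b, z (σ b) ^ 2 = ∑ b, z b ^ 2 := Equiv.sum_comp σ fun b => z b ^ 2
  unfold cappedDir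
  rw [h]
  split_ifs <;> rfl

theorem integrable_cappedDir {d : ℕ} (k : Fin d) :
    Integrable (fun z => cappedDir z k) (rowLaw d) :=
  Integrable.of_bound (measurable_cappedDir_apply k).aestronglyMeasurable 1
    (Filter.Eventually.of_forall fun z => abs_cappedDir_le_one z k)

theorem integrable_cappedDir_mul {d : ℕ} (k l : Fin d) :
    Integrable (fun z => cappedDir z k * cappedDir z l) (rowLaw d) :=
  Integrable.of_bound
    ((measurable_cappedDir_apply k).mul (measurable_cappedDir_apply l)).aestronglyMeasurable 1
    (Filter.Eventually.of_forall fun z => by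
      rw [Real.norm_eq_abs, abs_mul]
      exact mul_le_one₀ (abs_cappedDir_le_one z k) (abs_nonneg _) (abs_cappedDir_le_one z l))

theorem integral_cappedDir {d : ℕ} (k : Fin d) : ∫ z, cappedDir z k ∂(rowLaw d) = 0 := by
  have hmp := measurePreserving_flip d k
  have h : ∫ z, cappedDir z k ∂(rowLaw d) = ∫ z, -cappedDir z k ∂(rowLaw d) := by
    conv_lhs => rw [← hmp.map_eq]
    rw [integral_map hmp.aemeasurable (measurable_cappedDir_apply k).aestronglyMeasurable]
    simp [cappedDir_flip]
  rw [integral_neg] at h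
  linarith

theorem integral_cappedDir_mul_of_ne {d : ℕ} {k l : Fin d} (hkl : k ≠ l) :
    ∫ z, cappedDir z k * cappedDir z l ∂(rowLaw d) = 0 := by
  have hmp := measurePreserving_flip d k
  have h : ∫ z, cappedDir z k * cappedDir z l ∂(rowLaw d) =
      ∫ z, -(cappedDir z k * cappedDir z l) ∂(rowLaw d) := by
    conv_lhs => rw [← hmp.map_eq]
    rw [integral_map hmp.aemeasurable (by
      rw [hmp.map_eq]
      exact (integrable_cappedDir_mul k l).aestronglyMeasurable)]
    simp [cappedDir_flip, hkl.symm]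
  rw [integral_neg] at h
  linarith

theorem integral_cappedDir_sq_eq {d : ℕ} (k l : Fin d) :
    ∫ z, cappedDir z k * cappedDir z k ∂(rowLaw d) =
      ∫ z, cappedDir z l * cappedDir z l ∂(rowLaw d) := by
  have hmp := measurePreserving_perm d (Equiv.swap k l)
  conv_lhs => rw [← hmp.map_eq]
  rw [integral_map hmp.aemeasurable (by
      rw [hmp.map_eq]
      exact (integrable_cappedDir_mul k k).aestronglyMeasurable)]
  simp [cappedDir_perm]

theorem integral_dot_cappedDir {d : ℕ} (u : Fin d → ℝ) :
    ∫ z, u ⬝ᵥ cappedDir z ∂(rowLaw d) = 0 := by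
  simp only [dotProduct]
  rw [integral_finsetSum _ fun k _ => (integrable_cappedDir k).const_mul _]
  simp [integral_const_mul, integral_cappedDir]

/-- Sign flips kill the mixed moments and permutations make the d diagonal ones equal to a common q.
Since the direction has norm at most 1, d q ≤ 1, and the integral is q (u ⬝ᵥ v). -/
theorem abs_integral_dot_mul_dot_le {d : ℕ} (hd : 0 < d) (u v : Fin d → ℝ) :
    d * |∫ z, (u ⬝ᵥ cappedDir z) * (v ⬝ᵥ cappedDir z) ∂(rowLaw d)| ≤ |u ⬝ᵥ v| := by
  set q := ∫ z, cappedDir z ⟨0, hd⟩ * cappedDir z ⟨0, hd⟩ ∂(rowLaw d) with hq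
  have hq0 : 0 ≤ q := integral_nonneg fun z => mul_self_nonneg _
  have hq1 : d * q ≤ 1 := by
    calc d * q = ∑ k : Fin d, ∫ z, cappedDir z k * cappedDir z k ∂(rowLaw d) := by
          rw [Finset.sum_congr rfl fun k _ => integral_cappedDir_sq_eq k ⟨0, hd⟩]; simp [hq]
      _ = ∫ z, ∑ k : Fin d, cappedDir z k * cappedDir z k ∂(rowLaw d) :=
          (integral_finsetSum _ fun k _ => integrable_cappedDir_mul k k).symm
      _ ≤ ∫ _, (1 : ℝ) ∂(rowLaw d) := by
          refine integral_mono (integrable_finsetSum _ fun k _ => integrable_cappedDir_mul k k)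
            (integrable_const _) fun z => ?_
          simpa [sq] using sum_cappedDir_sq_le z
      _ = 1 := by simp
  have h : ∫ z, (u ⬝ᵥ cappedDir z) * (v ⬝ᵥ cappedDir z) ∂(rowLaw d) = q * (u ⬝ᵥ v) := by
    have h1 : ∀ z : Fin d → ℝ, (u ⬝ᵥ cappedDir z) * (v ⬝ᵥ cappedDir z) =
        ∑ k, ∑ l, (u k * v l) * (cappedDir z k * cappedDir z l) := by
      intro z
      simp only [dotProduct, Finset.sum_mul_sum]
      exact Finset.sum_congr rfl fun k _ => Finset.sum_congr rfl fun l _ => by ring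
    simp_rw [h1]
    rw [integral_finsetSum _ fun k _ => integrable_finsetSum _ fun l _ =>
      (integrable_cappedDir_mul k l).const_mul _]
    rw [dotProduct, Finset.mul_sum]
    refine Finset.sum_congr rfl fun k _ => ?_
    rw [integral_finsetSum _ fun l _ => (integrable_cappedDir_mul k l).const_mul _,
      Finset.sum_eq_single k]
    · rw [integral_const_mul, integral_cappedDir_sq_eq k ⟨0, hd⟩]; ring
    · intro l _ hl
      rw [integral_const_mul, integral_cappedDir_mul_of_ne hl.symm, mul_zero]
    · simp
  rw [h, abs_mul, abs_of_nonneg hq0, ← mul_assoc]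
  exact mul_le_of_le_one_left (abs_nonneg _) hq1

/-! ### Three-colouring the edges of a matching -/

theorem IsMatching.subset {m : ℕ} {M N : Finset (Fin m × Fin m)} (hM : IsMatching M) (h : N ⊆ M) :
    IsMatching N :=
  fun p hp q hq hpq => hM p (h hp) q (h hq) hpq

theorem IsMatching.card_filter_fst_le {m : ℕ} {M : Finset (Fin m × Fin m)} (hM : IsMatching M)
    (i : Fin m) : (M.filter fun p => p.1 = i).card ≤ 1 :=
  Finset.card_le_one.2 fun p hp q hq => by
    rw [Finset.mem_filter] at hp hq
    exact hM p hp.1 q hq.1 (Or.inl (hp.2.trans hq.2.symm))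

theorem IsMatching.card_filter_snd_le {m : ℕ} {M : Finset (Fin m × Fin m)} (hM : IsMatching M)
    (i : Fin m) : (M.filter fun p => p.2 = i).card ≤ 1 :=
  Finset.card_le_one.2 fun p hp q hq => by
    rw [Finset.mem_filter] at hp hq
    exact hM p hp.1 q hq.1 (Or.inr (hp.2.trans hq.2.symm))

/-- Edges of a loopless matching can be coloured with three colours such that consecutive edges get
different colours. -/
theorem IsMatching.exists_three_coloring {m : ℕ} (M : Finset (Fin m × Fin m)) (hM : IsMatching M)
    (hne : ∀ p ∈ M, p.1 ≠ p.2) :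
    ∃ c : Fin m × Fin m → Fin 3, ∀ p ∈ M, ∀ q ∈ M, p.2 = q.1 → c p ≠ c q := by
  classical
  induction M using Finset.induction_on with
  | empty => exact ⟨fun _ => 0, by simp⟩
  | insert e M he ih =>
    have hsub := Finset.subset_insert e M
    obtain ⟨c, hc⟩ := ih (hM.subset hsub) fun p hp => hne p (hsub hp)
    -- Greedy colouring: in a matching at most one edge starts at the target of `e` and at most one
    -- ends at its source, so at most two of the three colours are forbidden.
    set F := (M.filter fun q => q.1 = e.2).image c ∪ (M.filter fun q => q.2 = e.1).image c with hF
    have hcard : F.card < (Finset.univ : Finset (Fin 3)).card := by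
      have h1 := (hM.subset hsub).card_filter_fst_le e.2
      have h2 := (hM.subset hsub).card_filter_snd_le e.1
      have := Finset.card_union_le ((M.filter fun q => q.1 = e.2).image c)
        ((M.filter fun q => q.2 = e.1).image c)
      have h3 := Finset.card_image_le (s := M.filter fun q => q.1 = e.2) (f := c)
      have h4 := Finset.card_image_le (s := M.filter fun q => q.2 = e.1) (f := c)
      rw [hF, Finset.card_univ, Fintype.card_fin]
      omega
    obtain ⟨col, -, hcol⟩ := Finset.exists_mem_notMem_of_card_lt_card hcard
    have hne' : ∀ q ∈ M, q ≠ e := fun q hq h => he (h ▸ hq)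
    refine ⟨Function.update c e col, fun p hp q hq hpq => ?_⟩
    rcases Finset.mem_insert.1 hp with rfl | hp' <;> rcases Finset.mem_insert.1 hq with rfl | hq'
    · exact absurd hpq.symm (hne _ hp)
    · rw [Function.update_self, Function.update_of_ne (hne' q hq')]
      exact fun h => hcol (Finset.mem_union_left _
        (Finset.mem_image.2 ⟨q, Finset.mem_filter.2 ⟨hq', hpq.symm⟩, h.symm⟩))
    · rw [Function.update_self, Function.update_of_ne (hne' p hp')]
      exact fun h => hcol (Finset.mem_union_right _
        (Finset.mem_image.2 ⟨p, Finset.mem_filter.2 ⟨hp', hpq⟩, h⟩))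
    · rw [Function.update_of_ne (hne' q hq'), Function.update_of_ne (hne' p hp')]
      exact hc p hp' q hq' hpq

/-! ### Tail bounds for the Gram matrix of the capped directions -/

/-- The edges of `C` have pairwise disjoint sets of endpoints. -/
def DisjointEnds {m : ℕ} (C : Finset (Fin m × Fin m)) : Prop :=
  ∀ p ∈ C, ∀ q ∈ C, p ≠ q → p.1 ≠ q.1 ∧ p.1 ≠ q.2 ∧ p.2 ≠ q.1 ∧ p.2 ≠ q.2

/-- The law of the Gaussian embedding, as a product of row laws. -/
noncomputable abbrev rowsLaw (m d : ℕ) : Measure (Fin m → Fin d → ℝ) :=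
  Measure.pi fun _ => rowLaw d

theorem SubExp.comp_measurePreserving {Ω Ω' : Type*} [MeasurableSpace Ω] [MeasurableSpace Ω']
    {μ : Measure Ω} {μ' : Measure Ω'} {Y : Ω → ℝ} {K : ℝ} (hY : SubExp Y K μ) {f : Ω' → Ω}
    (hf : MeasurePreserving f μ' μ) : SubExp (fun ω => Y (f ω)) K μ' := by
  have hm := hY.measurable
  have hsm : AEStronglyMeasurable (fun ω => Real.exp (|Y ω| / K)) (μ'.map f) := by
    fun_prop
  refine ⟨hm.comp hf.measurable, ?_, ?_⟩
  · have := hY.integrable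
    rw [← hf.map_eq, integrable_map_measure hsm hf.aemeasurable] at this
    exact this
  · have := hY.le_two
    rw [← hf.map_eq, integral_map hf.aemeasurable hsm] at this
    exact this

theorem subExp_row_dot_sq {m d : ℕ} (hd : 0 < d) {u : Fin d → ℝ} (hu : ∑ k, u k ^ 2 ≤ 1)
    (a : Fin m) :
    SubExp (fun Z => (√d * (u ⬝ᵥ cappedDir (Z a))) ^ 2) 16 (rowsLaw m d) :=
  (subExp_dot_cappedDir_sq hd hu).comp_measurePreserving
    (measurePreserving_eval (fun _ : Fin m => rowLaw d) a)

theorem measurable_row_dot {m d : ℕ} (u : Fin d → ℝ) (a : Fin m) :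
    Measurable fun Z : Fin m → Fin d → ℝ => u ⬝ᵥ cappedDir (Z a) :=
  (measurable_dot_cappedDir u).comp (measurable_pi_apply a)

theorem measureReal_sum_sq_le {m d : ℕ} (hd : 0 < d) {u : Fin d → ℝ} (hu : ∑ k, u k ^ 2 ≤ 1)
    (S : Finset (Fin m)) (hS : S.card ≤ d) :
    (rowsLaw m d).real {Z | 17 < ∑ a ∈ S, (u ⬝ᵥ cappedDir (Z a)) ^ 2} ≤ tailBound d := by
  have hd' : (0 : ℝ) < d := by exact_mod_cast hd
  have hY := fun a : Fin m => subExp_row_dot_sq hd hu a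
  have hind : iIndepFun (fun (a : Fin m) (Z : Fin m → Fin d → ℝ) =>
      (√d * (u ⬝ᵥ cappedDir (Z a))) ^ 2) (rowsLaw m d) :=
    iIndepFun_pi (μ := fun _ : Fin m => rowLaw d)
      (X := fun _ z => (√d * (u ⬝ᵥ cappedDir z)) ^ 2) fun _ =>
        (((measurable_dot_cappedDir u).const_mul _).pow_const 2).aemeasurable
  have hB := SubExp.measureReal_abs_sum_ge_le (by norm_num) hY hind S hS
    (t := 1) (by norm_num) (by norm_num)
  refine (measureReal_mono fun Z hZ => ?_).trans
    (hB.trans (two_mul_exp_le_tailBound d (by norm_num)))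
  simp only [Set.mem_ofPred_eq] at hZ ⊢
  -- A crude mean: each term is bounded by its sub-exponential constant 16. The deviation 1 makes up
  -- the 17 of the statement.
  have h1 : ∑ a ∈ S, ∫ Z, (√d * (u ⬝ᵥ cappedDir (Z a))) ^ 2 ∂(rowsLaw m d) ≤ 16 * d := by
    calc _ ≤ ∑ a ∈ S, (16 : ℝ) := Finset.sum_le_sum fun a _ =>
          (le_abs_self _).trans ((hY a).abs_integral_le (by norm_num))
      _ = 16 * S.card := by rw [Finset.sum_const, nsmul_eq_mul, mul_comm]
      _ ≤ 16 * d := by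
          have : (S.card : ℝ) ≤ d := by exact_mod_cast hS
          linarith
  have h2 : ∑ a ∈ S, (√d * (u ⬝ᵥ cappedDir (Z a))) ^ 2 =
      d * ∑ a ∈ S, (u ⬝ᵥ cappedDir (Z a)) ^ 2 := by
    rw [Finset.mul_sum]
    exact Finset.sum_congr rfl fun a _ => by rw [mul_pow, Real.sq_sqrt hd'.le]
  refine le_trans ?_ (le_abs_self _)
  rw [h2]
  nlinarith

/-- For different rows the factors are independent and centred. For a loop the same row appears
twice, and the mean is small only if u and v are nearly orthogonal. -/
theorem abs_integral_row_mul_row_le {m d : ℕ} (hd : 0 < d) (u v : Fin d → ℝ) (a b : Fin m)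
    (h : a ≠ b ∨ |u ⬝ᵥ v| ≤ 1 / 64) :
    |∫ Z, (√d * (u ⬝ᵥ cappedDir (Z a))) * (√d * (v ⬝ᵥ cappedDir (Z b))) ∂(rowsLaw m d)| ≤
      1 / 64 := by
  have hd' : (0 : ℝ) < d := by exact_mod_cast hd
  have h0 : ∫ Z, (√d * (u ⬝ᵥ cappedDir (Z a))) * (√d * (v ⬝ᵥ cappedDir (Z b))) ∂(rowsLaw m d) =
      d * ∫ Z, (u ⬝ᵥ cappedDir (Z a)) * (v ⬝ᵥ cappedDir (Z b)) ∂(rowsLaw m d) := by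
    rw [← integral_const_mul]
    refine integral_congr_ae (Filter.Eventually.of_forall fun Z => ?_)
    have := Real.mul_self_sqrt hd'.le
    simp only
    linear_combination (u ⬝ᵥ cappedDir (Z a)) * (v ⬝ᵥ cappedDir (Z b)) * this
  rw [h0, abs_mul, abs_of_pos hd']
  by_cases hab : a = b
  · subst hab
    have hmp := measurePreserving_eval (fun _ : Fin m => rowLaw d) a
    have h1 : ∫ Z, (u ⬝ᵥ cappedDir (Z a)) * (v ⬝ᵥ cappedDir (Z a)) ∂(rowsLaw m d) =
        ∫ z, (u ⬝ᵥ cappedDir z) * (v ⬝ᵥ cappedDir z) ∂(rowLaw d) := by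
      rw [← hmp.map_eq, integral_map hmp.aemeasurable]
      exact ((measurable_dot_cappedDir u).mul (measurable_dot_cappedDir v)).aestronglyMeasurable
    rw [h1]
    exact (abs_integral_dot_mul_dot_le hd u v).trans (h.resolve_left (by simp))
  · have hind : iIndepFun (fun (a : Fin m) (Z : Fin m → Fin d → ℝ) => Z a) (rowsLaw m d) :=
      iIndepFun_pi (μ := fun _ : Fin m => rowLaw d) (X := fun _ z => z) fun _ => aemeasurable_id
    have h2 := (hind.indepFun hab).comp (measurable_dot_cappedDir u) (measurable_dot_cappedDir v)
    have h3 := h2.integral_fun_mul_eq_mul_integral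
      (measurable_row_dot u a).aestronglyMeasurable (measurable_row_dot v b).aestronglyMeasurable
    have hmp := measurePreserving_eval (fun _ : Fin m => rowLaw d) a
    have h4 : ∫ Z, u ⬝ᵥ cappedDir (Z a) ∂(rowsLaw m d) = 0 := by
      rw [← integral_dot_cappedDir u, ← hmp.map_eq, integral_map hmp.aemeasurable
        (measurable_dot_cappedDir u).aestronglyMeasurable]
    simp only [Function.comp_apply] at h3
    rw [h3]
    simp [h4]

theorem measureReal_bilinear_le {m d : ℕ} (hd : 0 < d) {u v : Fin d → ℝ} (hu : ∑ k, u k ^ 2 ≤ 1)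
    (hv : ∑ k, v k ^ 2 ≤ 1) (C : Finset (Fin m × Fin m)) (hC : C.card ≤ d) (hdis : DisjointEnds C)
    (hmean : (∀ e ∈ C, e.1 ≠ e.2) ∨ |u ⬝ᵥ v| ≤ 1 / 64) :
    (rowsLaw m d).real
      {Z | 1 / 32 < |∑ e ∈ C, (u ⬝ᵥ cappedDir (Z e.1)) * (v ⬝ᵥ cappedDir (Z e.2))|} ≤
      tailBound d := by
  have hd' : (0 : ℝ) < d := by exact_mod_cast hd
  let Y : C → (Fin m → Fin d → ℝ) → ℝ := fun e Z =>
    (√d * (u ⬝ᵥ cappedDir (Z e.1.1))) * (√d * (v ⬝ᵥ cappedDir (Z e.1.2)))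
  have hY : ∀ e, SubExp (Y e) 16 (rowsLaw m d) := fun e =>
    SubExp.mul (by norm_num) ((measurable_row_dot u _).const_mul _)
      ((measurable_row_dot v _).const_mul _) (subExp_row_dot_sq hd hu _)
      (subExp_row_dot_sq hd hv _)
  have hind0 : iIndepFun (fun (a : Fin m) (Z : Fin m → Fin d → ℝ) => Z a) (rowsLaw m d) :=
    iIndepFun_pi (μ := fun _ : Fin m => rowLaw d) (X := fun _ z => z) fun _ => aemeasurable_id
  -- Each term depends only on the two rows at the ends of its edge, and these pairs of rows are
  -- disjoint.
  have hblocks := iIndepFun_of_disjoint_blocks hind0 (fun a => measurable_pi_apply a)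
    (fun e : C => ({e.1.1, e.1.2} : Finset (Fin m))) (fun e f hef => by
      obtain ⟨h1, h2, h3, h4⟩ := hdis e.1 e.2 f.1 f.2 fun h => hef (Subtype.ext h)
      simp [Finset.disjoint_left, h1, h2, h3, h4])
  have hind : iIndepFun Y (rowsLaw m d) :=
    hblocks.comp (fun e f => (√d * (u ⬝ᵥ cappedDir (f ⟨e.1.1, by simp⟩))) *
      (√d * (v ⬝ᵥ cappedDir (f ⟨e.1.2, by simp⟩)))) fun e =>
      (((measurable_dot_cappedDir u).comp (measurable_pi_apply _)).const_mul _).mul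
        (((measurable_dot_cappedDir v).comp (measurable_pi_apply _)).const_mul _)
  -- A deviation of 1/64 on top of a mean of at most 1/64 gives the threshold 1/32.
  have hB := SubExp.measureReal_abs_sum_ge_le (by norm_num) hY hind Finset.univ (N := d)
    (by simpa using hC) (t := 1 / 64) (by norm_num) (by norm_num)
  refine (measureReal_mono fun Z hZ => ?_).trans
    (hB.trans (two_mul_exp_le_tailBound d (by norm_num)))
  simp only [Set.mem_ofPred_eq] at hZ ⊢
  have h1 : |∑ e, ∫ Z, Y e Z ∂(rowsLaw m d)| ≤ 1 / 64 * d := by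
    calc _ ≤ ∑ e, |∫ Z, Y e Z ∂(rowsLaw m d)| := Finset.abs_sum_le_sum_abs _ _
      _ ≤ ∑ e : C, (1 / 64 : ℝ) := Finset.sum_le_sum fun e _ =>
          abs_integral_row_mul_row_le hd u v _ _ (hmean.imp_left fun h => h e.1 e.2)
      _ = 1 / 64 * C.card := by simp [mul_comm]
      _ ≤ 1 / 64 * d := by
          have : (C.card : ℝ) ≤ d := by exact_mod_cast hC
          linarith
  have h2 : ∑ e, Y e Z =
      d * ∑ e ∈ C, (u ⬝ᵥ cappedDir (Z e.1)) * (v ⬝ᵥ cappedDir (Z e.2)) := by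
    rw [Finset.mul_sum, ← Finset.sum_coe_sort C]
    refine Finset.sum_congr rfl fun e _ => ?_
    have := Real.mul_self_sqrt hd'.le
    simp only [Y]
    linear_combination (u ⬝ᵥ cappedDir (Z e.1.1)) * (v ⬝ᵥ cappedDir (Z e.1.2)) * this
  have h3 := abs_sub_abs_le_abs_sub (∑ e, Y e Z) (∑ e, ∫ Z, Y e Z ∂(rowsLaw m d))
  rw [h2, abs_mul, abs_of_pos hd'] at h3
  rw [h2]
  nlinarith

/-- The Gram matrix of the capped directions of the rows of `Z`. -/
noncomputable def cappedGram {m d : ℕ} (Z : Fin m → Fin d → ℝ) (i a : Fin m) : ℝ :=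
  cappedDir (Z i) ⬝ᵥ cappedDir (Z a)

theorem measurable_cappedGram {m d : ℕ} (i a : Fin m) :
    Measurable fun Z : Fin m → Fin d → ℝ => cappedGram Z i a := by
  unfold cappedGram dotProduct
  exact Finset.measurable_sum _ fun k _ =>
    ((measurable_cappedDir_apply k).comp (measurable_pi_apply i)).mul
      ((measurable_cappedDir_apply k).comp (measurable_pi_apply a))

theorem measureReal_row_short_le {m d : ℕ} (hd : 0 < d) (a : Fin m) :
    (rowsLaw m d).real {Z | ∑ b, Z a b ^ 2 < 1 / 4} ≤ tailBound d := by
  have hmp := measurePreserving_eval (fun _ : Fin m => rowLaw d) a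
  have h := measureReal_short_le hd
  rwa [← hmp.measureReal_preimage
    (measurableSet_lt (by fun_prop) measurable_const).nullMeasurableSet] at h

/-- With row `i` frozen, the Gram entry is a linear form of the fresh row `a` whose coefficient
vector has norm at most 1. -/
theorem measureReal_cappedGram_gt_le {m d : ℕ} (hd : 0 < d) {i a : Fin m} (hia : a ≠ i) :
    (rowsLaw m d).real {Z | 1 / 64 < |cappedGram Z i a|} ≤ tailBound d := by
  refine pi_measureReal_le_of_forall_piecewise (rowLaw d) {i}
    (measurableSet_lt measurable_const (measurable_cappedGram i a).abs) (tailBound_nonneg d)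
    fun z => ?_
  have hmp := measurePreserving_eval (fun _ : Fin m => rowLaw d) a
  have h := measureReal_dot_cappedDir_gt_le hd (sum_cappedDir_sq_le (z i))
  rw [← hmp.measureReal_preimage (measurableSet_lt measurable_const
    (measurable_dot_cappedDir _).abs).nullMeasurableSet] at h
  simpa [cappedGram, hia] using h

theorem measureReal_sum_cappedGram_sq_le {m d : ℕ} (hd : 0 < d) {i : Fin m} (S : Finset (Fin m))
    (hS : S.card ≤ d) (hi : i ∉ S) :
    (rowsLaw m d).real {Z | 17 < ∑ a ∈ S, cappedGram Z i a ^ 2} ≤ tailBound d := by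
  refine pi_measureReal_le_of_forall_piecewise (rowLaw d) {i}
    (measurableSet_lt measurable_const
      (Finset.measurable_sum _ fun a _ => (measurable_cappedGram i a).pow_const 2))
    (tailBound_nonneg d) fun z => ?_
  refine le_trans (le_of_eq ?_) (measureReal_sum_sq_le hd (sum_cappedDir_sq_le (z i)) S hS)
  congr 1
  ext Z
  simp only [Set.mem_ofPred_eq, cappedGram]
  have : ∑ a ∈ S, (cappedDir (if i ∈ ({i} : Finset (Fin m)) then z i else Z i) ⬝ᵥ
      cappedDir (if a ∈ ({i} : Finset (Fin m)) then z a else Z a)) ^ 2 =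
      ∑ a ∈ S, (cappedDir (z i) ⬝ᵥ cappedDir (Z a)) ^ 2 :=
    Finset.sum_congr rfl fun a ha => by
      have hai : a ≠ i := fun h => hi (h ▸ ha)
      simp [hai]
  rw [this]

/-- Rows `i` and `j` are frozen; since `C` avoids both, the other rows stay fresh. The bound on the
Gram entry of `i` and `j`, needed for the means of loops, involves only frozen rows, so it can be
part of the event: where it is needed and fails, the event is empty. -/
theorem measureReal_sum_cappedGram_mul_le {m d : ℕ} (hd : 0 < d) {i j : Fin m}
    (C : Finset (Fin m × Fin m)) (hC : C.card ≤ d) (hdis : DisjointEnds C)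
    (havoid : ∀ e ∈ C, e.1 ≠ i ∧ e.1 ≠ j ∧ e.2 ≠ i ∧ e.2 ≠ j) :
    (rowsLaw m d).real {Z | ((∀ e ∈ C, e.1 ≠ e.2) ∨ |cappedGram Z i j| ≤ 1 / 64) ∧
      1 / 32 < |∑ e ∈ C, cappedGram Z i e.1 * cappedGram Z j e.2|} ≤ tailBound d := by
  refine pi_measureReal_le_of_forall_piecewise (rowLaw d) {i, j} ?_
    (tailBound_nonneg d) fun z => ?_
  · refine MeasurableSet.inter (MeasurableSet.union (MeasurableSet.const _) ?_) ?_
    · exact measurableSet_le (measurable_cappedGram i j).abs measurable_const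
    · have hm : Measurable fun Z : Fin m → Fin d → ℝ =>
          ∑ e ∈ C, cappedGram Z i e.1 * cappedGram Z j e.2 :=
        Finset.measurable_sum _ fun e _ =>
          (measurable_cappedGram i e.1).mul (measurable_cappedGram j e.2)
      exact measurableSet_lt measurable_const hm.abs
  · by_cases hz : (∀ e ∈ C, e.1 ≠ e.2) ∨ |cappedGram z i j| ≤ 1 / 64
    · refine le_trans (measureReal_mono fun Z hZ => ?_) (measureReal_bilinear_le hd
        (sum_cappedDir_sq_le (z i)) (sum_cappedDir_sq_le (z j)) C hC hdis hz)
      have h2 := hZ.2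
      have h3 : ∑ e ∈ C, cappedGram (fun a => if a ∈ ({i, j} : Finset (Fin m)) then z a else Z a)
          i e.1 * cappedGram (fun a => if a ∈ ({i, j} : Finset (Fin m)) then z a else Z a) j e.2 =
          ∑ e ∈ C, (cappedDir (z i) ⬝ᵥ cappedDir (Z e.1)) *
            (cappedDir (z j) ⬝ᵥ cappedDir (Z e.2)) :=
        Finset.sum_congr rfl fun e he => by
          obtain ⟨h1, h2, h3, h4⟩ := havoid e he
          simp [cappedGram, h1, h2, h3, h4]
      rw [h3] at h2
      exact h2
    · refine le_trans (le_of_eq ?_) (tailBound_nonneg d)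
      convert! measureReal_empty
      ext Z
      simp only [Set.mem_ofPred_eq, Set.mem_empty_iff_false, iff_false, cappedGram]
      rw [if_pos (by simp), if_pos (by simp)]
      exact fun h => hz h.1

/-! ### Rademacher signatures -/

theorem integral_rademacher (f : ℝ → ℝ) : ∫ x, f x ∂rademacher = (f 1 + f (-1)) / 2 := by
  rw [rademacher, integral_smul_measure, integral_add_measure (integrable_dirac (by simp))
    (integrable_dirac (by simp)), integral_dirac, integral_dirac]
  simp only [ENNReal.toReal_inv, ENNReal.toReal_ofNat, smul_eq_mul]
  ring

theorem hasSubgaussianMGF_rademacher : HasSubgaussianMGF (fun x => x) 1 rademacher := by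
  have h := hasSubgaussianMGF_of_mem_Icc_of_integral_eq_zero (μ := rademacher) (X := fun x => x)
    (a := -1) (b := 1) (by fun_prop) ?_ ?_
  · convert! h using 1
    ext
    simp
    norm_num
  · rw [rademacher]
    refine Measure.ae_smul_measure ?_ _
    rw [ae_add_measure_iff]
    constructor <;> exact (ae_dirac_iff measurableSet_Icc).2 (by norm_num)
  · rw [integral_rademacher]; norm_num

/-- The law of one column of the signature matrix. -/
noncomputable abbrev columnLaw (m : ℕ) : Measure (Fin m → ℝ) := Measure.pi fun _ => rademacher

theorem measurable_dot {m : ℕ} (u : Fin m → ℝ) : Measurable fun w : Fin m → ℝ => u ⬝ᵥ w := by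
  unfold dotProduct
  fun_prop

theorem subExp_column_dot_sq {m : ℕ} {u : Fin m → ℝ} {σ : ℝ} (hσ : 0 < σ)
    (hu : ∑ k, u k ^ 2 ≤ σ) : SubExp (fun w => (u ⬝ᵥ w) ^ 2) (4 * σ) (columnLaw m) := by
  obtain ⟨c, hc, hsg⟩ := hasSubgaussianMGF_dot (n := m) hasSubgaussianMGF_rademacher u
  exact subExp_sq_of_hasSubgaussianMGF hσ (by rw [hc]; simpa using hu) (measurable_dot u) hsg

theorem integrable_column_mul {m : ℕ} (a b : Fin m) :
    Integrable (fun w => w a * w b) (columnLaw m) := by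
  have h : ∀ a : Fin m, SubExp (fun w => w a ^ 2) (4 * 1) (columnLaw m) := fun a => by
    have := subExp_column_dot_sq (m := m) one_pos (u := Pi.single a 1) (by
      rw [Finset.sum_eq_single a (fun b _ hb => by simp [hb]) (by simp)]; simp)
    simpa using this
  exact (SubExp.mul (by norm_num) (by fun_prop) (by fun_prop) (h a) (h b)).integrable_self
    (by norm_num)

theorem integral_column_mul {m : ℕ} (a b : Fin m) :
    ∫ w, w a * w b ∂(columnLaw m) = if a = b then 1 else 0 := by
  have hmp := measurePreserving_eval (fun _ : Fin m => rademacher) a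
  split_ifs with hab
  · subst hab
    have h1 : ∫ w, w a * w a ∂(columnLaw m) = ∫ x, x * x ∂rademacher := by
      rw [← hmp.map_eq, integral_map hmp.aemeasurable (by fun_prop)]
    rw [h1, integral_rademacher]; norm_num
  · have hind : iIndepFun (fun (a : Fin m) (w : Fin m → ℝ) => w a) (columnLaw m) :=
      iIndepFun_pi (μ := fun _ : Fin m => rademacher) (X := fun _ x => x) fun _ => aemeasurable_id
    have h1 : ∫ w, w a ∂(columnLaw m) = 0 := by
      have : ∫ w, w a ∂(columnLaw m) = ∫ x, x ∂rademacher := by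
        rw [← hmp.map_eq, integral_map hmp.aemeasurable (by fun_prop)]
      rw [this, integral_rademacher]; norm_num
    rw [(hind.indepFun hab).integral_fun_mul_eq_mul_integral
      (measurable_pi_apply a).aestronglyMeasurable (measurable_pi_apply b).aestronglyMeasurable, h1,
      zero_mul]

theorem integral_column_dot_mul_dot {m : ℕ} (u v : Fin m → ℝ) :
    ∫ w, (u ⬝ᵥ w) * (v ⬝ᵥ w) ∂(columnLaw m) = u ⬝ᵥ v := by
  have h1 : ∀ w : Fin m → ℝ, (u ⬝ᵥ w) * (v ⬝ᵥ w) =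
      ∑ k, ∑ l, (u k * v l) * (w k * w l) := by
    intro w
    simp only [dotProduct, Finset.sum_mul_sum]
    exact Finset.sum_congr rfl fun k _ => Finset.sum_congr rfl fun l _ => by ring
  simp_rw [h1]
  rw [integral_finsetSum _ fun k _ => integrable_finsetSum _ fun l _ =>
    (integrable_column_mul k l).const_mul _]
  refine Finset.sum_congr rfl fun k _ => ?_
  rw [integral_finsetSum _ fun l _ => (integrable_column_mul k l).const_mul _]
  simp [integral_const_mul, integral_column_mul]

theorem measurePreserving_column {m n : ℕ} (c : Fin n) :
    MeasurePreserving (fun (w : Fin m → Fin n → ℝ) b => w b c) (signatureLaw m n) (columnLaw m) :=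
  measurePreserving_pi (fun _ : Fin m => Measure.pi fun _ : Fin n => rademacher)
    (fun _ : Fin m => rademacher) (f := fun _ x => x c)
    fun _ => measurePreserving_eval (fun _ : Fin n => rademacher) c

theorem iIndepFun_column (m n : ℕ) :
    iIndepFun (fun (c : Fin n) (w : Fin m → Fin n → ℝ) b => w b c) (signatureLaw m n) := by
  have h0 : iIndepFun (fun (p : Fin m × Fin n) (w : Fin m → Fin n → ℝ) => w p.1 p.2)
      (signatureLaw m n) := by
    have := iIndepFun_uncurry_infinitePi' (ι := Fin m) (κ := Fin n) (X := fun _ _ x => x)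
      (fun _ _ => rademacher) (fun _ _ => measurable_id)
    simp only [Measure.infinitePi_eq_pi] at this
    exact this
  have h1 := iIndepFun_of_disjoint_blocks h0 (fun p => by fun_prop)
    (fun c : Fin n => Finset.univ.image fun b : Fin m => (b, c)) (fun c c' hc => by
      simp only [Finset.disjoint_left, Finset.mem_image]
      rintro _ ⟨b, -, rfl⟩ ⟨b', -, h⟩
      exact hc (congrArg Prod.snd h).symm)
  exact h1.comp (fun c f b => f ⟨(b, c), by simp⟩) fun c => by fun_prop

/-- Conditionally on the embedding, a score is a sum over independent columns of products of two
Rademacher forms. Squared norms at most 18 give them the sub-exponential constant 4 · 18 = 72. -/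
theorem measureReal_signature_le {m n : ℕ} {u v : Fin m → ℝ} (hu : ∑ k, u k ^ 2 ≤ 18)
    (hv : ∑ k, v k ^ 2 ≤ 18) :
    (signatureLaw m n).real {w | 1 / 8 * (n : ℝ) ≤
      |∑ c, (∑ b, u b * w b c) * (∑ b, v b * w b c) - n * ∑ b, u b * v b|} ≤ tailBound n := by
  have hY : ∀ c : Fin n, SubExp (fun w : Fin m → Fin n → ℝ =>
      (u ⬝ᵥ fun b => w b c) * (v ⬝ᵥ fun b => w b c)) 72 (signatureLaw m n) := by
    intro c
    have h1 := subExp_column_dot_sq (σ := 18) (by norm_num) hu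
    have h2 := subExp_column_dot_sq (σ := 18) (by norm_num) hv
    have h3 := SubExp.mul (by norm_num) (measurable_dot u) (measurable_dot v) h1 h2
    norm_num at h3
    exact h3.comp_measurePreserving (measurePreserving_column c)
  have hind := (iIndepFun_column m n).comp (fun _ w => (u ⬝ᵥ w) * (v ⬝ᵥ w)) fun _ =>
    (measurable_dot u).mul (measurable_dot v)
  have hmean : ∀ c : Fin n, ∫ w, (u ⬝ᵥ fun b => w b c) * (v ⬝ᵥ fun b => w b c)
      ∂(signatureLaw m n) = u ⬝ᵥ v := by
    intro c
    have hmp := measurePreserving_column (m := m) c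
    have hsm : AEStronglyMeasurable (fun w : Fin m → ℝ => (u ⬝ᵥ w) * (v ⬝ᵥ w))
        ((signatureLaw m n).map fun w b => w b c) :=
      ((measurable_dot u).mul (measurable_dot v)).aestronglyMeasurable
    rw [← integral_column_dot_mul_dot u v, ← hmp.map_eq, integral_map hmp.aemeasurable hsm]
  have hB := SubExp.measureReal_abs_sum_ge_le (by norm_num) hY hind Finset.univ (N := n)
    (by simp) (t := 1 / 8) (by norm_num) (by norm_num)
  simp only [hmean, Finset.sum_const, Finset.card_univ, Fintype.card_fin, nsmul_eq_mul] at hB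
  exact hB.trans (two_mul_exp_le_tailBound n (by norm_num))

/-! ### Scores of a head -/

/-- Every fibre has at most one edge, so no cross terms arise. -/
theorem IsMatching.sum_fiber_mul {m : ℕ} {M : Finset (Fin m × Fin m)} (hM : IsMatching M)
    (f f' : Fin m × Fin m → ℝ) :
    ∑ b, (∑ p ∈ M.filter (fun p => p.2 = b), f p) * (∑ p ∈ M.filter (fun p => p.2 = b), f' p) =
      ∑ p ∈ M, f p * f' p := by
  rw [← Finset.sum_fiberwise M Prod.snd fun p => f p * f' p]
  refine Finset.sum_congr rfl fun b _ => ?_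
  have : Nonempty (Fin m × Fin m) := ⟨(b, b)⟩
  obtain ⟨q, hq⟩ := Finset.card_le_one_iff_subset_singleton.1 (hM.card_filter_snd_le b)
  rcases Finset.subset_singleton_iff.1 hq with h | h <;> rw [h] <;> simp

/-- Queries and keys are both expanded in the signatures, indexed by targets b: the edge into b
contributes the Gram entry with its source to the query and the one with its target to the key. -/
theorem headScore_eq {m d n : ℕ} (X : Matrix (Fin m) (Fin d) ℝ) {M : Finset (Fin m × Fin m)}
    (hM : IsMatching M) (w : Fin m → Fin n → ℝ) (i j : Fin m) :
    headScore X (queryWeights X M w) (keyWeights X M w) i j =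
      ∑ c, (∑ b, (∑ p ∈ M.filter (fun p => p.2 = b), X i ⬝ᵥ X p.1) * w b c) *
        (∑ b, (∑ p ∈ M.filter (fun p => p.2 = b), X j ⬝ᵥ X p.2) * w b c) := by
  have hgram : ∀ i a, (X * X.transpose) i a = X i ⬝ᵥ X a := fun i a => rfl
  unfold headScore queryWeights keyWeights
  rw [← Matrix.mul_assoc, ← Matrix.mul_assoc, dotProduct]
  refine Finset.sum_congr rfl fun c _ => ?_
  congr 1
  · rw [Matrix.mul_apply]
    simp only [hgram, queryTemplate, Matrix.of_apply, Finset.sum_apply, Finset.mul_sum,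
      Finset.sum_mul]
    have h1 : ∀ a, ∑ p ∈ M.filter (fun p => p.1 = a), X i ⬝ᵥ X a * w p.2 c =
        ∑ p ∈ M.filter (fun p => p.1 = a), X i ⬝ᵥ X p.1 * w p.2 c := fun a =>
      Finset.sum_congr rfl fun p hp => by rw [(Finset.mem_filter.1 hp).2]
    have h2 : ∀ b, ∑ p ∈ M.filter (fun p => p.2 = b), X i ⬝ᵥ X p.1 * w b c =
        ∑ p ∈ M.filter (fun p => p.2 = b), X i ⬝ᵥ X p.1 * w p.2 c := fun b =>
      Finset.sum_congr rfl fun p hp => by rw [(Finset.mem_filter.1 hp).2]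
    simp only [h1, h2]
    rw [Finset.sum_fiberwise M Prod.fst fun p => X i ⬝ᵥ X p.1 * w p.2 c,
      Finset.sum_fiberwise M Prod.snd fun p => X i ⬝ᵥ X p.1 * w p.2 c]
  · rw [Matrix.mul_apply]
    refine Finset.sum_congr rfl fun b _ => ?_
    simp only [hgram, keyTemplate, Matrix.of_apply]
    have : Nonempty (Fin m × Fin m) := ⟨(b, b)⟩
    obtain ⟨q, hq⟩ := Finset.card_le_one_iff_subset_singleton.1 (hM.card_filter_snd_le b)
    by_cases hb : b ∈ M.image Prod.snd
    · obtain ⟨p, hp, rfl⟩ := Finset.mem_image.1 hb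
      have hpf : p ∈ M.filter (fun q => q.2 = p.2) := Finset.mem_filter.2 ⟨hp, rfl⟩
      have : M.filter (fun q => q.2 = p.2) = {p} :=
        Finset.eq_singleton_iff_unique_mem.2 ⟨hpf, fun x hx => by
          have h1 := Finset.mem_singleton.1 (hq hx)
          have h2 := Finset.mem_singleton.1 (hq hpf)
          rw [h1, h2]⟩
      rw [this, if_pos hb]
      simp
    · have : M.filter (fun q => q.2 = b) = ∅ :=
        Finset.filter_eq_empty_iff.2 fun p hp h => hb (Finset.mem_image.2 ⟨p, hp, h⟩)
      rw [this, if_neg hb]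
      simp

/-- The diagonal part of the score of `(i, j)` is close to `1` if the matching contains `(i, j)`
and small otherwise. -/
theorem IsMatching.gram_sum_bounds {m : ℕ} {M : Finset (Fin m × Fin m)} (hM : IsMatching M)
    (c : Fin m × Fin m → Fin 3) (g : Fin m → Fin m → ℝ) (hdiag : ∀ i, g i i = 1)
    (hoff : ∀ i a, a ≠ i → |g i a| ≤ 1 / 64) (i j : Fin m)
    (hcol : ∀ r, |∑ p ∈ M.filter (fun p => (p.1 ≠ i ∧ p.1 ≠ j ∧ p.2 ≠ i ∧ p.2 ≠ j) ∧
      p.1 ≠ p.2 ∧ c p = r), g i p.1 * g j p.2| ≤ 1 / 32)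
    (hloop : i ≠ j → |∑ p ∈ M.filter (fun p => (p.1 ≠ i ∧ p.1 ≠ j ∧ p.2 ≠ i ∧ p.2 ≠ j) ∧
      p.1 = p.2), g i p.1 * g j p.2| ≤ 1 / 32) :
    ((i, j) ∈ M → 3 / 4 ≤ ∑ p ∈ M, g i p.1 * g j p.2) ∧
      ((i, j) ∉ M → (i ≠ j ∨ ∀ p ∈ M, p.1 ≠ p.2) → ∑ p ∈ M, g i p.1 * g j p.2 ≤ 1 / 4) := by
  classical
  have hle1 : ∀ i a, |g i a| ≤ 1 := fun i a => by
    by_cases h : a = i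
    · rw [h, hdiag, abs_one]
    · exact (hoff i a h).trans (by norm_num)
  set f : Fin m × Fin m → ℝ := fun p => g i p.1 * g j p.2 with hf
  have hterm : ∀ p, p ≠ (i, j) → |f p| ≤ 1 / 64 := by
    intro p hp
    rw [hf, abs_mul]
    by_cases h1 : p.1 = i
    · have h2 : p.2 ≠ j := fun h2 => hp (Prod.ext h1 h2)
      nlinarith [hle1 i p.1, hoff j p.2 h2, abs_nonneg (g i p.1), abs_nonneg (g j p.2)]
    · nlinarith [hle1 j p.2, hoff i p.1 h1, abs_nonneg (g i p.1), abs_nonneg (g j p.2)]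
  let A : Fin m × Fin m → Prop := fun p => p.1 ≠ i ∧ p.1 ≠ j ∧ p.2 ≠ i ∧ p.2 ≠ j
  -- At most four edges touch i or j, and apart from (i, j) each contributes at most 1/64. With 1/32
  -- for each of three colours and for the loops (when i ≠ j), the noise is at most 6/32 < 1/4.
  set T := M.filter fun p => ¬ A p with hT
  have hTcard : T.card ≤ 4 := by
    have hsub : T ⊆ ((M.filter fun p => p.1 = i) ∪ (M.filter fun p => p.1 = j)) ∪
        ((M.filter fun p => p.2 = i) ∪ (M.filter fun p => p.2 = j)) := by
      intro p hp
      simp only [hT, A, Finset.mem_filter, Finset.mem_union] at hp ⊢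
      tauto
    have h1 := hM.card_filter_fst_le i
    have h2 := hM.card_filter_fst_le j
    have h3 := hM.card_filter_snd_le i
    have h4 := hM.card_filter_snd_le j
    have := Finset.card_le_card hsub
    have h5 := Finset.card_union_le ((M.filter fun p => p.1 = i) ∪ (M.filter fun p => p.1 = j))
      ((M.filter fun p => p.2 = i) ∪ (M.filter fun p => p.2 = j))
    have h6 := Finset.card_union_le (M.filter fun p => p.1 = i) (M.filter fun p => p.1 = j)
    have h7 := Finset.card_union_le (M.filter fun p => p.2 = i) (M.filter fun p => p.2 = j)
    omega
  have hTerase : |∑ p ∈ T.erase (i, j), f p| ≤ 1 / 16 := by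
    calc _ ≤ ∑ p ∈ T.erase (i, j), |f p| := Finset.abs_sum_le_sum_abs _ _
      _ ≤ ∑ p ∈ T.erase (i, j), (1 / 64 : ℝ) :=
          Finset.sum_le_sum fun p hp => hterm p (Finset.ne_of_mem_erase hp)
      _ = (T.erase (i, j)).card * (1 / 64) := by rw [Finset.sum_const, nsmul_eq_mul]
      _ ≤ 4 * (1 / 64) := by
          have : ((T.erase (i, j)).card : ℝ) ≤ 4 := by
            exact_mod_cast (Finset.card_erase_le).trans hTcard
          gcongr
      _ = 1 / 16 := by norm_num
  have hsplit : ∑ p ∈ M, f p = ∑ p ∈ T, f p + (∑ p ∈ M.filter (fun p => A p ∧ p.1 = p.2), f p +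
      ∑ p ∈ M.filter (fun p => A p ∧ p.1 ≠ p.2), f p) := by
    rw [← Finset.sum_filter_not_add_sum_filter M A, ← Finset.sum_filter_add_sum_filter_not
      (M.filter A) fun p => p.1 = p.2, Finset.filter_filter, Finset.filter_filter]
  have hnl : |∑ p ∈ M.filter (fun p => A p ∧ p.1 ≠ p.2), f p| ≤ 3 / 32 := by
    rw [← Finset.sum_fiberwise _ c f]
    refine (Finset.abs_sum_le_sum_abs _ _).trans ?_
    calc _ ≤ ∑ r : Fin 3, (1 / 32 : ℝ) := by
          refine Finset.sum_le_sum fun r _ => ?_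
          rw [Finset.filter_filter]
          simpa only [A, and_assoc] using hcol r
      _ = 3 / 32 := by simp; norm_num
  have hnl' := abs_le.1 hnl
  have hT' := abs_le.1 hTerase
  -- On the diagonal the loop terms are squares and need not be small. Their sign suffices for the
  -- lower bound; the upper bound then assumes that there are no loops.
  have hloop_nonneg : i = j → 0 ≤ ∑ p ∈ M.filter (fun p => A p ∧ p.1 = p.2), f p := by
    rintro rfl
    refine Finset.sum_nonneg fun p hp => ?_
    rw [hf]
    simp only
    rw [(Finset.mem_filter.1 hp).2.2]
    exact mul_self_nonneg _
  constructor
  · intro hij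
    have hijT : (i, j) ∈ T := Finset.mem_filter.2 ⟨hij, fun h => h.1 rfl⟩
    have h1 : ∑ p ∈ T, f p = 1 + ∑ p ∈ T.erase (i, j), f p := by
      rw [← Finset.add_sum_erase T f hijT, hf]
      simp only [hdiag, mul_one]
    have h2 : -(1 / 32) ≤ ∑ p ∈ M.filter (fun p => A p ∧ p.1 = p.2), f p := by
      by_cases h : i = j
      · linarith [hloop_nonneg h]
      · exact (abs_le.1 (hloop h)).1
    rw [hsplit, h1]
    linarith
  · intro hij hor
    have h1 : T.erase (i, j) = T :=
      Finset.erase_eq_of_notMem fun h => hij (Finset.mem_filter.1 h).1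
    rw [h1] at hT'
    have h2 : ∑ p ∈ M.filter (fun p => A p ∧ p.1 = p.2), f p ≤ 1 / 32 := by
      by_cases h : i = j
      · rw [Finset.filter_eq_empty_iff.2 fun p hp h' =>
          hor.resolve_left (by simpa using h) p hp h'.2]
        simp
      · exact (abs_le.1 (hloop h)).2
    rw [hsplit]
    linarith

/-! ### The union bound -/

theorem measureReal_iUnion_le_card_mul {Ω ι : Type*} [MeasurableSpace Ω] [Fintype ι]
    {μ : Measure Ω} [IsProbabilityMeasure μ] {B : ι → Set Ω} {p : ℝ} (h : ∀ i, μ.real (B i) ≤ p) :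
    μ.real (⋃ i, B i) ≤ Fintype.card ι * p := by
  refine (measureReal_iUnion_fintype_le B).trans ?_
  calc _ ≤ ∑ _ : ι, p := Finset.sum_le_sum fun i _ => h i
    _ = _ := by simp

theorem mem_edges {m : ℕ} {G : Digraph (Fin m)} {p : Fin m × Fin m} :
    p ∈ edges G ↔ G.Adj p.1 p.2 := by
  simp [edges]

/-- The signature coefficients of the query of item `i`. -/
noncomputable def queryCoeff {m d : ℕ} (M : Finset (Fin m × Fin m)) (Z : Fin m → Fin d → ℝ)
    (i b : Fin m) : ℝ :=
  ∑ p ∈ M.filter (fun p => p.2 = b), cappedGram Z i p.1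

/-- The signature coefficients of the key of item `j`. -/
noncomputable def keyCoeff {m d : ℕ} (M : Finset (Fin m × Fin m)) (Z : Fin m → Fin d → ℝ)
    (j b : Fin m) : ℝ :=
  ∑ p ∈ M.filter (fun p => p.2 = b), cappedGram Z j p.2

theorem measurable_queryCoeff {m d : ℕ} (M : Finset (Fin m × Fin m)) (i b : Fin m) :
    Measurable fun Z : Fin m → Fin d → ℝ => queryCoeff M Z i b :=
  Finset.measurable_sum _ fun p _ => measurable_cappedGram i p.1

theorem measurable_keyCoeff {m d : ℕ} (M : Finset (Fin m × Fin m)) (i b : Fin m) :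
    Measurable fun Z : Fin m → Fin d → ℝ => keyCoeff M Z i b :=
  Finset.measurable_sum _ fun p _ => measurable_cappedGram i p.2

/-- The signatures fail to concentrate on the pair `(i, j)` in the head of `M`. -/
def badSignature {m d : ℕ} (n : ℕ) (M : Finset (Fin m × Fin m)) (i j : Fin m) :
    Set ((Fin m → Fin d → ℝ) × (Fin m → Fin n → ℝ)) :=
  {ω | (∑ b, queryCoeff M ω.1 i b ^ 2 ≤ 18 ∧ ∑ b, keyCoeff M ω.1 j b ^ 2 ≤ 18) ∧
    1 / 8 * (n : ℝ) ≤ |∑ c, (∑ b, queryCoeff M ω.1 i b * ω.2 b c) *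
      (∑ b, keyCoeff M ω.1 j b * ω.2 b c) - n * ∑ b, queryCoeff M ω.1 i b * keyCoeff M ω.1 j b|}

/-- The norm conditions are part of the event, so for every fixed embedding either they hold and the
signature estimate applies, or the section is empty. -/
theorem measureReal_badSignature_le {m d n : ℕ} (M : Finset (Fin m × Fin m)) (i j : Fin m) :
    (constructionLaw m d n).real (badSignature n M i j) ≤ tailBound n := by
  have hq : ∀ b, Measurable fun ω : (Fin m → Fin d → ℝ) × (Fin m → Fin n → ℝ) =>
      queryCoeff M ω.1 i b := fun b => (measurable_queryCoeff M i b).comp measurable_fst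
  have hk : ∀ b, Measurable fun ω : (Fin m → Fin d → ℝ) × (Fin m → Fin n → ℝ) =>
      keyCoeff M ω.1 j b := fun b => (measurable_keyCoeff M j b).comp measurable_fst
  have h₁ : Measurable fun ω : (Fin m → Fin d → ℝ) × (Fin m → Fin n → ℝ) =>
      ∑ b, queryCoeff M ω.1 i b ^ 2 := by fun_prop
  have h₂ : Measurable fun ω : (Fin m → Fin d → ℝ) × (Fin m → Fin n → ℝ) =>
      ∑ b, keyCoeff M ω.1 j b ^ 2 := by fun_prop
  have h₃ : Measurable fun ω : (Fin m → Fin d → ℝ) × (Fin m → Fin n → ℝ) =>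
      |∑ c, (∑ b, queryCoeff M ω.1 i b * ω.2 b c) * (∑ b, keyCoeff M ω.1 j b * ω.2 b c) -
        n * ∑ b, queryCoeff M ω.1 i b * keyCoeff M ω.1 j b| := by fun_prop
  refine prod_measureReal_le_of_forall _ _ ?_ (tailBound_nonneg n) fun Z => ?_
  · exact ((measurableSet_le h₁ measurable_const).inter
      (measurableSet_le h₂ measurable_const)).inter (measurableSet_le measurable_const h₃)
  · by_cases h : ∑ b, queryCoeff M Z i b ^ 2 ≤ 18 ∧ ∑ b, keyCoeff M Z j b ^ 2 ≤ 18
    · exact (measureReal_mono fun w hw => hw.2).trans (measureReal_signature_le h.1 h.2)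
    · refine le_trans (le_of_eq ?_) (tailBound_nonneg n)
      convert! measureReal_empty
      ext w
      simp only [badSignature, Set.mem_ofPred_eq, Set.mem_empty_iff_false, iff_false]
      exact fun hw => h hw.1

/-- The edges of `M` that avoid `i` and `j` and have colour `r`, respectively are loops. -/
def avoidingClass {m : ℕ} (M : Finset (Fin m × Fin m)) (c : Fin m × Fin m → Fin 3) (i j : Fin m) :
    Option (Fin 3) → Finset (Fin m × Fin m)
  | some r => M.filter fun p => (p.1 ≠ i ∧ p.1 ≠ j ∧ p.2 ≠ i ∧ p.2 ≠ j) ∧ p.1 ≠ p.2 ∧ c p = r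
  | none => M.filter fun p => (p.1 ≠ i ∧ p.1 ≠ j ∧ p.2 ≠ i ∧ p.2 ≠ j) ∧ p.1 = p.2

/-- The colouring `c` gives different colours to consecutive edges of `M` that are not loops. -/
def IsPathColoring {m : ℕ} (M : Finset (Fin m × Fin m)) (c : Fin m × Fin m → Fin 3) : Prop :=
  ∀ p ∈ M, ∀ q ∈ M, p.1 ≠ p.2 → q.1 ≠ q.2 → p.2 = q.1 → c p ≠ c q

theorem IsMatching.exists_isPathColoring {m : ℕ} {M : Finset (Fin m × Fin m)}
    (hM : IsMatching M) : ∃ c, IsPathColoring M c := by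
  obtain ⟨c, hc⟩ := IsMatching.exists_three_coloring (M.filter fun p => p.1 ≠ p.2)
    (hM.subset (Finset.filter_subset _ _)) fun p hp => (Finset.mem_filter.1 hp).2
  exact ⟨c, fun p hp q hq hp' hq' => hc p (Finset.mem_filter.2 ⟨hp, hp'⟩) q
    (Finset.mem_filter.2 ⟨hq, hq'⟩)⟩

theorem avoidingClass_subset {m : ℕ} (M : Finset (Fin m × Fin m)) (c : Fin m × Fin m → Fin 3)
    (i j : Fin m) (o : Option (Fin 3)) : avoidingClass M c i j o ⊆ M := by
  cases o <;> exact Finset.filter_subset _ _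

theorem avoidingClass_avoids {m : ℕ} {M : Finset (Fin m × Fin m)} {c : Fin m × Fin m → Fin 3}
    {i j : Fin m} {o : Option (Fin 3)} {e : Fin m × Fin m} (he : e ∈ avoidingClass M c i j o) :
    e.1 ≠ i ∧ e.1 ≠ j ∧ e.2 ≠ i ∧ e.2 ≠ j := by
  cases o <;> exact (Finset.mem_filter.1 he).2.1

/-- The matching property separates sources from sources and targets from targets. A source equal to
the target of another edge would make the two edges consecutive, which the colouring excludes. -/
theorem disjointEnds_avoidingClass {m : ℕ} {M : Finset (Fin m × Fin m)} (hM : IsMatching M)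
    {c : Fin m × Fin m → Fin 3} (hc : IsPathColoring M c) (i j : Fin m) (o : Option (Fin 3)) :
    DisjointEnds (avoidingClass M c i j o) := by
  intro p hp q hq hpq
  have hpM := avoidingClass_subset M c i j o hp
  have hqM := avoidingClass_subset M c i j o hq
  have h1 : p.1 ≠ q.1 := fun h => hpq (hM p hpM q hqM (Or.inl h))
  have h2 : p.2 ≠ q.2 := fun h => hpq (hM p hpM q hqM (Or.inr h))
  cases o with
  | none =>
    have h3 : p.1 = p.2 := (Finset.mem_filter.1 hp).2.2
    have h4 : q.1 = q.2 := (Finset.mem_filter.1 hq).2.2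
    exact ⟨h1, h4 ▸ h1, h3 ▸ h1, h2⟩
  | some r =>
    have h3 := (Finset.mem_filter.1 hp).2.2
    have h4 := (Finset.mem_filter.1 hq).2.2
    exact ⟨h1, fun h => hc q hqM p hpM h4.1 h3.1 h.symm (h4.2.trans h3.2.symm),
      fun h => hc p hpM q hqM h3.1 h4.1 h (h3.2.trans h4.2.symm), h2⟩

/-- The embedding is well conditioned for the matching `M` with path colouring `c`. -/
structure WellConditioned {m d : ℕ} (M : Finset (Fin m × Fin m)) (c : Fin m × Fin m → Fin 3)
    (Z : Fin m → Fin d → ℝ) : Prop where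
  norm : ∀ a, 1 / 4 ≤ ∑ b, Z a b ^ 2
  off_diag : ∀ i a, a ≠ i → |cappedGram Z i a| ≤ 1 / 64
  source : ∀ i, ∑ a ∈ (M.image Prod.fst).erase i, cappedGram Z i a ^ 2 ≤ 17
  target : ∀ j, ∑ a ∈ (M.image Prod.snd).erase j, cappedGram Z j a ^ 2 ≤ 17
  avoiding : ∀ i j o, (o = none → i ≠ j) →
    |∑ p ∈ avoidingClass M c i j o, cappedGram Z i p.1 * cappedGram Z j p.2| ≤ 1 / 32

/-- The count of bad events: m short rows, m² Gram entries, 2 m h sums over sources or targets, and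
4 m² h sums over the three colours and the loops. -/
theorem measureReal_not_wellConditioned_le {m d h : ℕ} (hd : 0 < d)
    {M : Fin h → Finset (Fin m × Fin m)} (hM : ∀ k, IsMatching (M k)) (hcard : ∀ k, (M k).card ≤ d)
    {c : Fin h → Fin m × Fin m → Fin 3} (hc : ∀ k, IsPathColoring (M k) (c k)) :
    (gaussianRows m d).real {Z | ¬ ∀ k, WellConditioned (M k) (c k) Z} ≤
      (m + m * m + 2 * (m * h) + 4 * (m * m * h)) * tailBound d := by
  let B₁ : Fin m → Set (Fin m → Fin d → ℝ) := fun a => {Z | ∑ b, Z a b ^ 2 < 1 / 4}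
  let B₂ : Fin m × Fin m → Set (Fin m → Fin d → ℝ) := fun x =>
    {Z | x.2 ≠ x.1 ∧ 1 / 64 < |cappedGram Z x.1 x.2|}
  let B₃ : (Fin m × Fin h) ⊕ (Fin m × Fin h) → Set (Fin m → Fin d → ℝ) :=
    Sum.elim (fun x => {Z | 17 < ∑ a ∈ ((M x.2).image Prod.fst).erase x.1, cappedGram Z x.1 a ^ 2})
      (fun x => {Z | 17 < ∑ a ∈ ((M x.2).image Prod.snd).erase x.1, cappedGram Z x.1 a ^ 2})
  let C : Fin m × Fin m × Fin h × Option (Fin 3) → Finset (Fin m × Fin m) := fun x =>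
    avoidingClass (M x.2.2.1) (c x.2.2.1) x.1 x.2.1 x.2.2.2
  let B₄ : Fin m × Fin m × Fin h × Option (Fin 3) → Set (Fin m → Fin d → ℝ) := fun x =>
    {Z | ((∀ e ∈ C x, e.1 ≠ e.2) ∨ |cappedGram Z x.1 x.2.1| ≤ 1 / 64) ∧
      1 / 32 < |∑ e ∈ C x, cappedGram Z x.1 e.1 * cappedGram Z x.2.1 e.2|}
  have h₁ : ∀ x, (gaussianRows m d).real (B₁ x) ≤ tailBound d := measureReal_row_short_le hd
  have h₂ : ∀ x, (gaussianRows m d).real (B₂ x) ≤ tailBound d := by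
    intro x
    by_cases hx : x.2 = x.1
    · have : B₂ x = ∅ := by ext Z; simp [B₂, hx]
      rw [this, measureReal_empty]
      exact tailBound_nonneg d
    · exact (measureReal_mono fun Z hZ => hZ.2).trans (measureReal_cappedGram_gt_le hd hx)
  have h₃ : ∀ x, (gaussianRows m d).real (B₃ x) ≤ tailBound d := by
    rintro (x | x)
    · exact measureReal_sum_cappedGram_sq_le hd _
        ((Finset.card_erase_le.trans Finset.card_image_le).trans (hcard _))
        (Finset.notMem_erase _ _)
    · exact measureReal_sum_cappedGram_sq_le hd _
        ((Finset.card_erase_le.trans Finset.card_image_le).trans (hcard _))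
        (Finset.notMem_erase _ _)
  have h₄ : ∀ x, (gaussianRows m d).real (B₄ x) ≤ tailBound d := fun x =>
    measureReal_sum_cappedGram_mul_le hd (C x)
      ((Finset.card_le_card (avoidingClass_subset _ _ _ _ _)).trans (hcard _))
      (disjointEnds_avoidingClass (hM _) (hc _) _ _ _) fun e he => avoidingClass_avoids he
  have hsub : {Z | ¬ ∀ k, WellConditioned (M k) (c k) Z} ⊆
      ((⋃ x, B₁ x) ∪ (⋃ x, B₂ x)) ∪ ((⋃ x, B₃ x) ∪ (⋃ x, B₄ x)) := by
    intro Z hZ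
    by_contra hcon
    refine hZ fun k => ?_
    simp only [Set.mem_union, Set.mem_iUnion, not_or, not_exists] at hcon
    obtain ⟨⟨n₁, n₂⟩, n₃, n₄⟩ := hcon
    have hoff : ∀ i a, a ≠ i → |cappedGram Z i a| ≤ 1 / 64 := fun i a ha =>
      not_lt.1 fun h => n₂ (i, a) ⟨ha, h⟩
    refine ⟨fun a => not_lt.1 (n₁ a), hoff, fun i => not_lt.1 (n₃ (Sum.inl (i, k))),
      fun j => not_lt.1 (n₃ (Sum.inr (j, k))), fun i j o ho => not_lt.1 fun h =>
        n₄ (i, j, k, o) ⟨?_, h⟩⟩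
    -- Loop sums rely on the off-diagonal bound, colour classes on the absence of loops.
    cases o with
    | none => exact Or.inr (hoff i j (ho rfl).symm)
    | some r => exact Or.inl fun e he => (Finset.mem_filter.1 he).2.2.1
  refine (measureReal_mono hsub).trans ?_
  refine (measureReal_union_le _ _).trans ((add_le_add (measureReal_union_le _ _)
    (measureReal_union_le _ _)).trans ?_)
  have c₁ := measureReal_iUnion_le_card_mul h₁
  have c₂ := measureReal_iUnion_le_card_mul h₂
  have c₃ := measureReal_iUnion_le_card_mul h₃
  have c₄ := measureReal_iUnion_le_card_mul h₄
  simp only [Fintype.card_prod, Fintype.card_sum, Fintype.card_fin, Fintype.card_option,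
    Nat.cast_mul, Nat.cast_add, Nat.cast_ofNat] at c₁ c₂ c₃ c₄
  norm_num at c₄
  linarith

/-! ### Separation on the good event -/

theorem normalizeRows_row_eq {m d : ℕ} {Z : Fin m → Fin d → ℝ} {i : Fin m}
    (h : 1 / 4 ≤ ∑ b, Z i b ^ 2) : normalizeRows Z i = cappedDir (Z i) := by
  rw [cappedDir, if_pos h]
  rfl

theorem cappedGram_self {m d : ℕ} {Z : Fin m → Fin d → ℝ} {i : Fin m}
    (h : 1 / 4 ≤ ∑ b, Z i b ^ 2) : cappedGram Z i i = 1 := by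
  rw [← sum_cappedDir_sq_eq h, cappedGram, dotProduct]
  exact Finset.sum_congr rfl fun k _ => (sq _).symm

/-- If the embedding is well conditioned and the signatures concentrate, then the scores of a head
separate the edges of its matching from the other pairs. -/
theorem headScore_bounds {m d n : ℕ} (hn : 0 < n) {M : Finset (Fin m × Fin m)} (hM : IsMatching M)
    {c : Fin m × Fin m → Fin 3} {Z : Fin m → Fin d → ℝ} (hZ : WellConditioned M c Z)
    {w : Fin m → Fin n → ℝ} {i j : Fin m} (hw : (Z, w) ∉ badSignature n M i j) :
    ((i, j) ∈ M → (n : ℝ) / 2 < headScore (normalizeRows Z) (queryWeights (normalizeRows Z) M w)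
      (keyWeights (normalizeRows Z) M w) i j) ∧
    ((i, j) ∉ M → (i ≠ j ∨ ∀ p ∈ M, p.1 ≠ p.2) →
      headScore (normalizeRows Z) (queryWeights (normalizeRows Z) M w)
        (keyWeights (normalizeRows Z) M w) i j < (n : ℝ) / 2) := by
  have hn' : (0 : ℝ) < n := by exact_mod_cast hn
  have hdiag := fun i => cappedGram_self (hZ.norm i)
  have hrow : ∀ i a, normalizeRows Z i ⬝ᵥ normalizeRows Z a = cappedGram Z i a := fun i a => by
    rw [normalizeRows_row_eq (hZ.norm i), normalizeRows_row_eq (hZ.norm a)]; rfl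
  -- The diagonal entry g(i, i) = 1, excluded from the probabilistic bound 17, adds at most 1.
  have h18 : ∀ (S : Finset (Fin m)) (i : Fin m), ∑ a ∈ S.erase i, cappedGram Z i a ^ 2 ≤ 17 →
      ∑ a ∈ S, cappedGram Z i a ^ 2 ≤ 18 := by
    intro S i hS
    by_cases hi : i ∈ S
    · rw [← Finset.add_sum_erase S _ hi, hdiag]; linarith
    · rw [Finset.erase_eq_of_notMem hi] at hS; linarith
  have hq : ∑ b, queryCoeff M Z i b ^ 2 ≤ 18 := by
    have h1 := hM.sum_fiber_mul (fun p => cappedGram Z i p.1) (fun p => cappedGram Z i p.1)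
    have h2 : ∑ a ∈ M.image Prod.fst, cappedGram Z i a ^ 2 = ∑ p ∈ M, cappedGram Z i p.1 ^ 2 :=
      Finset.sum_image fun p hp q hq hpq => hM p hp q hq (Or.inl hpq)
    simp only [← sq] at h1
    exact (h1.trans h2.symm).le.trans (h18 _ i (hZ.source i))
  have hk : ∑ b, keyCoeff M Z j b ^ 2 ≤ 18 := by
    have h1 := hM.sum_fiber_mul (fun p => cappedGram Z j p.2) (fun p => cappedGram Z j p.2)
    have h2 : ∑ a ∈ M.image Prod.snd, cappedGram Z j a ^ 2 = ∑ p ∈ M, cappedGram Z j p.2 ^ 2 :=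
      Finset.sum_image fun p hp q hq hpq => hM p hp q hq (Or.inr hpq)
    simp only [← sq] at h1
    exact (h1.trans h2.symm).le.trans (h18 _ j (hZ.target j))
  have hD : ∑ b, queryCoeff M Z i b * keyCoeff M Z j b =
      ∑ p ∈ M, cappedGram Z i p.1 * cappedGram Z j p.2 := hM.sum_fiber_mul _ _
  have hS : headScore (normalizeRows Z) (queryWeights (normalizeRows Z) M w)
      (keyWeights (normalizeRows Z) M w) i j =
      ∑ c, (∑ b, queryCoeff M Z i b * w b c) * (∑ b, keyCoeff M Z j b * w b c) := by
    rw [headScore_eq _ hM]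
    simp only [hrow]
    rfl
  have hdev : |headScore (normalizeRows Z) (queryWeights (normalizeRows Z) M w)
      (keyWeights (normalizeRows Z) M w) i j -
      n * ∑ p ∈ M, cappedGram Z i p.1 * cappedGram Z j p.2| < 1 / 8 * n := by
    rw [hS, ← hD]
    exact not_le.1 fun h => hw ⟨⟨hq, hk⟩, h⟩
  obtain ⟨h1, h2⟩ := hM.gram_sum_bounds c (cappedGram Z) hdiag hZ.off_diag i j
    (fun r => hZ.avoiding i j (some r) (by simp)) (fun hij => hZ.avoiding i j none fun _ => hij)
  obtain ⟨h3, h4⟩ := abs_lt.1 hdev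
  refine ⟨fun hij => ?_, fun hij hor => ?_⟩
  · have := h1 hij
    nlinarith
  · have := h2 hij hor
    nlinarith

theorem separates_of_wellConditioned {m d n h : ℕ} (hn : 0 < n) (hh : 0 < h) {G : Digraph (Fin m)}
    {M : Fin h → Finset (Fin m × Fin m)} (hM : IsPacking G d h M)
    {c : Fin h → Fin m × Fin m → Fin 3} {Z : Fin m → Fin d → ℝ}
    (hZ : ∀ k, WellConditioned (M k) (c k) Z) {w : Fin m → Fin n → ℝ}
    (hw : ∀ i j k, (Z, w) ∉ badSignature n (M k) i j) :
    Separates G (maxScore (normalizeRows Z) M w) ((n : ℝ) / 2) := by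
  have : Nonempty (Fin h) := ⟨⟨0, hh⟩⟩
  have hmem : ∀ k, ∀ p ∈ M k, G.Adj p.1 p.2 := fun k p hp =>
    mem_edges.1 (hM.union ▸ Finset.mem_biUnion.2 ⟨k, Finset.mem_univ _, hp⟩)
  intro i j
  refine ⟨fun hij => ?_, fun hij hor => ?_⟩
  · have h1 : (i, j) ∈ Finset.univ.biUnion M := by
      rw [hM.union]
      exact mem_edges.2 hij
    obtain ⟨k, -, hk⟩ := Finset.mem_biUnion.1 h1
    exact ((headScore_bounds hn (hM.matching k) (hZ k) (hw i j k)).1 hk).trans_le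
      (le_ciSup (f := fun k => headScore (normalizeRows Z) (queryWeights (normalizeRows Z) (M k) w)
        (keyWeights (normalizeRows Z) (M k) w) i j) (Set.finite_range _).bddAbove k)
  · obtain ⟨k, hk⟩ := exists_eq_ciSup_of_finite (f := fun k => headScore (normalizeRows Z)
      (queryWeights (normalizeRows Z) (M k) w) (keyWeights (normalizeRows Z) (M k) w) i j)
    rw [maxScore, ← hk]
    exact (headScore_bounds hn (hM.matching k) (hZ k) (hw i j k)).2 (fun hk => hij (hmem k _ hk))
      (hor.imp_right fun hv p hp hpp => hv p.1 (by have := hmem k p hp; rwa [← hpp] at this))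

theorem separates_measureReal_ge {m d n h : ℕ} (hd : 0 < d) (hn : 0 < n) (hh : 0 < h)
    {G : Digraph (Fin m)} {M : Fin h → Finset (Fin m × Fin m)} (hM : IsPacking G d h M) :
    1 - ((m + m * m + 2 * (m * h) + 4 * (m * m * h)) * tailBound d +
        m * m * h * tailBound n) ≤
      (constructionLaw m d n).real
        {ω | Separates G (maxScore (normalizeRows ω.1) M ω.2) ((n : ℝ) / 2)} := by
  choose c hc using fun k => (hM.matching k).exists_isPathColoring
  set S := {ω : (Fin m → Fin d → ℝ) × (Fin m → Fin n → ℝ) |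
    Separates G (maxScore (normalizeRows ω.1) M ω.2) ((n : ℝ) / 2)} with hS
  set B := {Z : Fin m → Fin d → ℝ | ¬ ∀ k, WellConditioned (M k) (c k) Z} with hB
  let A : Fin m × Fin m × Fin h → Set ((Fin m → Fin d → ℝ) × (Fin m → Fin n → ℝ)) := fun x =>
    badSignature n (M x.2.2) x.1 x.2.1
  have hcover : Set.univ ⊆ S ∪ (B ×ˢ Set.univ ∪ ⋃ x, A x) := by
    rintro ⟨Z, w⟩ -
    by_contra hcon
    simp only [Set.mem_union, Set.mem_iUnion, not_or, not_exists, Set.mem_prod, Set.mem_univ,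
      and_true] at hcon
    obtain ⟨n₁, n₂, n₃⟩ := hcon
    exact n₁ (separates_of_wellConditioned hn hh hM (not_not.1 n₂) fun i j k => n₃ (i, j, k))
  have h1 : (constructionLaw m d n).real (B ×ˢ Set.univ) ≤
      (m + m * m + 2 * (m * h) + 4 * (m * m * h)) * tailBound d := by
    refine le_trans (le_of_eq ?_) (measureReal_not_wellConditioned_le hd hM.matching hM.card_le hc)
    rw [constructionLaw, measureReal_prod_prod]
    simp [hB]
  have h2 : (constructionLaw m d n).real (⋃ x, A x) ≤ m * m * h * tailBound n := by
    have := measureReal_iUnion_le_card_mul (μ := constructionLaw m d n) (B := A) fun x =>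
      measureReal_badSignature_le (M x.2.2) x.1 x.2.1
    simpa [Fintype.card_prod, mul_assoc] using this
  have h3 := measureReal_mono (μ := constructionLaw m d n) hcover
  rw [probReal_univ] at h3
  have h4 := measureReal_union_le (μ := constructionLaw m d n) S (B ×ˢ Set.univ ∪ ⋃ x, A x)
  have h5 := measureReal_union_le (μ := constructionLaw m d n) (B ×ˢ Set.univ) (⋃ x, A x)
  linarith

/-! ### Consequences of bounded skew -/

theorem numEdges_le_mul {m : ℕ} (G : Digraph (Fin m)) : numEdges G ≤ m * maxDegree G := by
  have h := Finset.card_eq_sum_card_fiberwise (s := edges G) (f := Prod.fst) (t := Finset.univ)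
    (fun _ _ => Finset.mem_coe.2 (Finset.mem_univ _))
  rw [numEdges, h]
  calc _ ≤ ∑ _ : Fin m, maxDegree G := Finset.sum_le_sum fun i hi =>
        (Finset.le_sup (f := outDegree G) hi).trans (le_max_left _ _)
    _ = _ := by simp

theorem numEdges_le_sq {m : ℕ} (G : Digraph (Fin m)) : numEdges G ≤ m * m := by
  simpa [numEdges] using Finset.card_le_univ (edges G)

theorem maxDegree_pos {m : ℕ} {G : Digraph (Fin m)} (h : 0 < numEdges G) : 0 < maxDegree G :=
  Nat.pos_of_ne_zero fun h0 => by simpa [h0, h.ne'] using numEdges_le_mul G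

theorem pos_of_numEdges_pos {m : ℕ} {G : Digraph (Fin m)} (h : 0 < numEdges G) : 0 < m :=
  Nat.pos_of_ne_zero fun h0 => by
    subst h0
    have := numEdges_le_sq G
    omega

theorem boundedSkew_iff {m d : ℕ} {G : Digraph (Fin m)} (hd : 0 < d) (hE : 0 < numEdges G) :
    BoundedSkew d G ↔ (maxDegree G : ℝ) ≤ (numEdges G : ℝ) / d := by
  have hd' : (0 : ℝ) < d := by exact_mod_cast hd
  have hE' : (0 : ℝ) < numEdges G := by exact_mod_cast hE
  have hm' : (0 : ℝ) < m := by exact_mod_cast pos_of_numEdges_pos hE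
  rw [BoundedSkew, avgDegree, div_le_div_iff₀ (by positivity) hd', le_div_iff₀ hd',
    mul_div_assoc', le_div_iff₀ hm']
  constructor
  · intro h
    have : (maxDegree G * d : ℝ) * m ≤ numEdges G * m := by
      by_contra hcon
      rw [not_le] at hcon
      nlinarith
    exact le_of_mul_le_mul_right this hm'
  · intro h
    nlinarith

section Admissible

variable {m d : ℕ} {c₀ : ℝ} {G : Digraph (Fin m)}

theorem Admissible.dim_pos (h : Admissible c₀ d G) : 0 < d := by
  refine Nat.pos_of_ne_zero fun h0 => ?_
  have h1 := h.skew
  have hE' : (0 : ℝ) < numEdges G := by exact_mod_cast h.edges_pos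
  have hm' : (0 : ℝ) < m := by exact_mod_cast pos_of_numEdges_pos h.edges_pos
  have hD : (0 : ℝ) < maxDegree G := by exact_mod_cast maxDegree_pos h.edges_pos
  -- Since m / 0 = 0 while the left side is positive, bounded skew already excludes d = 0.
  rw [BoundedSkew, avgDegree, h0, Nat.cast_zero, div_zero] at h1
  exact absurd h1 (not_le.2 (by positivity))

theorem Admissible.maxDegree_le (h : Admissible c₀ d G) :
    (maxDegree G : ℝ) ≤ (numEdges G : ℝ) / d :=
  (boundedSkew_iff h.dim_pos h.edges_pos).1 h.skew

theorem Admissible.one_le_div (h : Admissible c₀ d G) : 1 ≤ (numEdges G : ℝ) / d :=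
  le_trans (by exact_mod_cast maxDegree_pos h.edges_pos) h.maxDegree_le

/-- From Δ d ≤ m' ≤ m Δ. The padding in the packing needs this. -/
theorem Admissible.dim_le (h : Admissible c₀ d G) : d ≤ m := by
  have hd' : (0 : ℝ) < d := by exact_mod_cast h.dim_pos
  have h1 := h.maxDegree_le
  rw [le_div_iff₀ hd'] at h1
  have h2 : maxDegree G * d ≤ numEdges G := by exact_mod_cast h1
  have h3 := h2.trans (numEdges_le_mul G)
  rw [mul_comm m] at h3
  exact Nat.le_of_mul_le_mul_left h3 (maxDegree_pos h.edges_pos)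

theorem Admissible.div_le_numHeads : (numEdges G : ℝ) / d ≤ numHeads d G := Nat.le_ceil _

/-- Rounding up at most doubles m' / d, because m' / d ≥ Δ ≥ 1. -/
theorem Admissible.numHeads_le (h : Admissible c₀ d G) :
    (numHeads d G : ℝ) ≤ 2 * ((numEdges G : ℝ) / d) := by
  have := Nat.ceil_lt_add_one (R := ℝ) (a := (numEdges G : ℝ) / d) (by positivity)
  have h1 := h.one_le_div
  rw [numHeads]
  linarith

theorem Admissible.numHeads_pos (h : Admissible c₀ d G) : 0 < numHeads d G :=
  Nat.ceil_pos.2 (zero_lt_one.trans_le h.one_le_div)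

theorem Admissible.numHeads_le_sq (h : Admissible c₀ d G) : numHeads d G ≤ m * m := by
  refine le_trans (Nat.ceil_le.2 ?_) (numEdges_le_sq G)
  exact div_le_self (by positivity) (by exact_mod_cast h.dim_pos)

theorem Admissible.exists_isPacking (h : Admissible c₀ d G) :
    ∃ M : Fin (numHeads d G) → Finset (Fin m × Fin m), IsPacking G d (numHeads d G) M := by
  have hd' : (0 : ℝ) < d := by exact_mod_cast h.dim_pos
  have h1 := Admissible.div_le_numHeads (d := d) (G := G)
  refine RGR.exists_isPacking G d _ h.dim_le ?_ ?_
  · exact_mod_cast h.maxDegree_le.trans h1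
  · rw [div_le_iff₀ hd'] at h1
    exact_mod_cast h1

theorem Admissible.log_nonneg (h : Admissible c₀ d G) : 0 ≤ Real.log m :=
  Real.log_nonneg (by exact_mod_cast pos_of_numEdges_pos h.edges_pos)

theorem Admissible.log_numEdges_le (h : Admissible c₀ d G) :
    Real.log (numEdges G) ≤ 2 * Real.log m := by
  have hE' : (0 : ℝ) < numEdges G := by exact_mod_cast h.edges_pos
  have : (numEdges G : ℝ) ≤ (m : ℝ) ^ 2 := by
    rw [sq]; exact_mod_cast numEdges_le_sq G
  calc Real.log (numEdges G) ≤ Real.log ((m : ℝ) ^ 2) := Real.log_le_log hE' this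
    _ = _ := by rw [Real.log_pow]; norm_num

end Admissible

/-! ### The size of the construction -/

/-- For m ≥ 2 rounding adds at most 1 ≤ 2 log 2 ≤ 2 log m; for m = 1 both sides vanish. -/
theorem headWidth_le {C : ℝ} (hC : 0 ≤ C) {m : ℕ} (hm : 0 < m) :
    (headWidth C m : ℝ) ≤ (C + 2) * Real.log m := by
  rcases Nat.lt_or_ge 1 m with h | h
  · have h2 : Real.log 2 ≤ Real.log m := Real.log_le_log (by norm_num) (by exact_mod_cast h)
    have h3 := Real.log_two_gt_d9
    have h0 : 0 ≤ C * Real.log m := mul_nonneg hC (by linarith)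
    have := Nat.ceil_lt_add_one h0
    rw [headWidth]
    linarith
  · have : m = 1 := by omega
    simp [this, headWidth]

theorem Admissible.le_totalKeyDim {m d : ℕ} {c₀ : ℝ} {G : Digraph (Fin m)}
    (h : Admissible c₀ d G) {C : ℝ} (hC : 0 ≤ C) :
    C * ((numEdges G : ℝ) / d * Real.log m) ≤ totalKeyDim C d G := by
  rw [totalKeyDim, Nat.cast_mul]
  have h1 := Admissible.div_le_numHeads (d := d) (G := G)
  have h2 : C * Real.log m ≤ headWidth C m := Nat.le_ceil _
  have h3 := h.log_nonneg
  calc C * ((numEdges G : ℝ) / d * Real.log m) = (numEdges G : ℝ) / d * (C * Real.log m) := by ring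
    _ ≤ _ := mul_le_mul h1 h2 (by positivity) (by positivity)

theorem Admissible.totalKeyDim_le {m d : ℕ} {c₀ : ℝ} {G : Digraph (Fin m)}
    (h : Admissible c₀ d G) {C : ℝ} (hC : 0 ≤ C) :
    (totalKeyDim C d G : ℝ) ≤ 2 * (C + 2) * ((numEdges G : ℝ) / d * Real.log m) := by
  rw [totalKeyDim, Nat.cast_mul]
  have h1 := h.numHeads_le
  have h2 := headWidth_le hC (pos_of_numEdges_pos h.edges_pos)
  calc _ ≤ 2 * ((numEdges G : ℝ) / d) * ((C + 2) * Real.log m) :=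
        mul_le_mul h1 h2 (by positivity) (by positivity)
    _ = _ := by ring

/-! ### The total failure probability -/

theorem tailBound_le {m n : ℕ} (hm : 0 < m) (h : 12 * 2 ^ 26 * Real.log m ≤ n) :
    tailBound n ≤ 2 * ((m : ℝ) ^ 12)⁻¹ := by
  have hm' : (0 : ℝ) < m := by exact_mod_cast hm
  rw [tailBound]
  have h1 : Real.exp (-(n / 2 ^ 26)) ≤ ((m : ℝ) ^ 12)⁻¹ := by
    calc Real.exp (-(n / 2 ^ 26)) ≤ Real.exp (-(12 * Real.log m)) := by
          rw [Real.exp_le_exp, neg_le_neg_iff, le_div_iff₀ (by positivity)]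
          linarith
      _ = _ := by
          rw [Real.exp_neg, show (12 : ℝ) * Real.log m = Real.log ((m : ℝ) ^ 12) by
            rw [Real.log_pow]; norm_num, Real.exp_log (by positivity)]
  linarith

/-- As h ≤ m², there are at most 9 m⁴ events of probability 2 m⁻¹² each, and 18 m⁻⁸ ≤ m⁻³ because m⁵
≥ 32. -/
theorem union_bound_le {m h : ℕ} {p q : ℝ} (hm : 2 ≤ m) (hh : h ≤ m * m)
    (hp : p ≤ 2 * ((m : ℝ) ^ 12)⁻¹) (hq : q ≤ 2 * ((m : ℝ) ^ 12)⁻¹) :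
    (m + m * m + 2 * (m * h) + 4 * (m * m * h)) * p + m * m * h * q ≤ ((m : ℝ) ^ 3)⁻¹ := by
  have hm2 : (2 : ℝ) ≤ m := by exact_mod_cast hm
  have hm1 : (1 : ℝ) ≤ m := by linarith
  have hh' : (h : ℝ) ≤ (m : ℝ) ^ 2 := by rw [sq]; exact_mod_cast hh
  have hx : (0 : ℝ) ≤ 2 * ((m : ℝ) ^ 12)⁻¹ := by positivity
  have e1 : (m : ℝ) ≤ (m : ℝ) ^ 4 := le_self_pow₀ hm1 (by norm_num)
  have e2 : (m : ℝ) * m ≤ (m : ℝ) ^ 4 := by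
    rw [← sq]; exact pow_le_pow_right₀ hm1 (by norm_num)
  have e3 : (m : ℝ) * h ≤ (m : ℝ) ^ 4 := by
    calc (m : ℝ) * h ≤ m * (m : ℝ) ^ 2 := by gcongr
      _ = (m : ℝ) ^ 3 := by ring
      _ ≤ _ := pow_le_pow_right₀ hm1 (by norm_num)
  have e4 : (m : ℝ) * m * h ≤ (m : ℝ) ^ 4 := by
    calc (m : ℝ) * m * h ≤ m * m * (m : ℝ) ^ 2 := by gcongr
      _ = _ := by ring
  have e5 : (32 : ℝ) ≤ (m : ℝ) ^ 5 := by
    calc (32 : ℝ) = 2 ^ 5 := by norm_num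
      _ ≤ _ := by gcongr
  calc _ ≤ (m + m * m + 2 * (m * h) + 4 * (m * m * h)) * (2 * ((m : ℝ) ^ 12)⁻¹) +
        m * m * h * (2 * ((m : ℝ) ^ 12)⁻¹) := by gcongr
    _ = (m + m * m + 2 * (m * h) + 5 * (m * m * h)) * (2 * ((m : ℝ) ^ 12)⁻¹) := by ring
    _ ≤ (9 * (m : ℝ) ^ 4) * (2 * ((m : ℝ) ^ 12)⁻¹) :=
        mul_le_mul_of_nonneg_right (by linarith) hx
    _ = 18 * ((m : ℝ) ^ 8)⁻¹ := by field_simp; norm_num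
    _ ≤ ((m : ℝ) ^ 3)⁻¹ := by
        rw [← div_eq_mul_inv, div_le_iff₀ (by positivity),
          show (m : ℝ) ^ 8 = (m : ℝ) ^ 3 * (m : ℝ) ^ 5 by ring,
          inv_mul_cancel_left₀ (by positivity)]
        linarith

theorem Admissible.separates {m d : ℕ} {G : Digraph (Fin m)}
    (h : Admissible (12 * 2 ^ 26) d G) {C : ℝ} (hC : 12 * 2 ^ 26 ≤ C)
    {M : Fin (numHeads d G) → Finset (Fin m × Fin m)} (hM : IsPacking G d (numHeads d G) M) :
    1 - ((m : ℝ) ^ 3)⁻¹ ≤ (constructionLaw m d (headWidth C m)).real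
      {ω | Separates G (maxScore (normalizeRows ω.1) M ω.2) ((headWidth C m : ℝ) / 2)} := by
  have hm := pos_of_numEdges_pos h.edges_pos
  rcases Nat.lt_or_ge 1 m with hm1 | hm1
  · have hlog : 0 < Real.log m := Real.log_pos (by exact_mod_cast hm1)
    have hw : 12 * 2 ^ 26 * Real.log m ≤ headWidth C m :=
      (mul_le_mul_of_nonneg_right hC hlog.le).trans (Nat.le_ceil _)
    have hn : 0 < headWidth C m := by
      have : (0 : ℝ) < headWidth C m := lt_of_lt_of_le (by positivity) hw
      exact_mod_cast this
    refine le_trans ?_ (separates_measureReal_ge h.dim_pos hn h.numHeads_pos hM)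
    have := union_bound_le hm1 h.numHeads_le_sq (tailBound_le hm h.dim_ge) (tailBound_le hm hw)
    linarith
  -- For m = 1 the claimed probability is 0.
  · have : m = 1 := by omega
    subst this
    simp

end RGR

/-! ### The corollary -/

theorem mainTheorem4 :
    -- the two forms of the skew condition are equivalent
    (∀ (m d : ℕ) (G : Digraph (Fin m)), 0 < d → 0 < RGR.numEdges G →
      (RGR.BoundedSkew d G ↔ (RGR.maxDegree G : ℝ) ≤ (RGR.numEdges G : ℝ) / d)) ∧
    ∃ c₀ : ℝ, 0 < c₀ ∧ ∃ C₀ : ℝ, 0 < C₀ ∧ ∀ C : ℝ, C₀ ≤ C →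
      -- the construction with `⌈m' / d⌉` heads of width `⌈C log m⌉` exists and separates
      (∀ (m d : ℕ) (G : Digraph (Fin m)), RGR.Admissible c₀ d G →
        (∃ M : Fin (RGR.numHeads d G) → Finset (Fin m × Fin m),
          RGR.IsPacking G d (RGR.numHeads d G) M) ∧
        ∀ M : Fin (RGR.numHeads d G) → Finset (Fin m × Fin m),
          RGR.IsPacking G d (RGR.numHeads d G) M →
          1 - ((m : ℝ) ^ 3)⁻¹ ≤
            (RGR.constructionLaw m d (RGR.headWidth C m)).real
              {ω | RGR.Separates G (RGR.maxScore (RGR.normalizeRows ω.1) M ω.2)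
                ((RGR.headWidth C m : ℝ) / 2)}) ∧
      -- `D_K = Θ(m' log m / d)`, and `D_K = Ω(m' log m' / d)`
      (∃ a : ℝ, 0 < a ∧ ∃ b : ℝ, 0 < b ∧
        ∀ (m d : ℕ) (G : Digraph (Fin m)), RGR.Admissible c₀ d G →
          a * ((RGR.numEdges G : ℝ) * Real.log m / d) ≤ RGR.totalKeyDim C d G ∧
          (RGR.totalKeyDim C d G : ℝ) ≤ b * ((RGR.numEdges G : ℝ) * Real.log m / d) ∧
          a * ((RGR.numEdges G : ℝ) * Real.log (RGR.numEdges G) / d) ≤ RGR.totalKeyDim C d G) ∧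
      -- `D_K = O(m' log m' / d)`, hence `Θ`, as soon as `m'` is at least a fixed power of `m`
      (∀ δ : ℝ, 0 < δ → ∃ b : ℝ, 0 < b ∧
        ∀ (m d : ℕ) (G : Digraph (Fin m)), RGR.Admissible c₀ d G →
          (m : ℝ) ^ δ ≤ RGR.numEdges G →
          (RGR.totalKeyDim C d G : ℝ) ≤
            b * ((RGR.numEdges G : ℝ) * Real.log (RGR.numEdges G) / d)) ∧
      -- `D_K` has the order of the lower bound `(m' / d) log (m² / m')` if `m' = O(m ^ (2 - ε))`
      (∀ ε : ℝ, 0 < ε → ∀ K : ℝ, 0 < K → ∃ a : ℝ, 0 < a ∧ ∃ b : ℝ, 0 < b ∧ ∃ m₀ : ℕ,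
        ∀ (m d : ℕ) (G : Digraph (Fin m)), m₀ ≤ m → RGR.Admissible c₀ d G →
          (RGR.numEdges G : ℝ) ≤ K * (m : ℝ) ^ (2 - ε) →
          a * ((RGR.numEdges G : ℝ) / d * Real.log ((m : ℝ) ^ 2 / RGR.numEdges G)) ≤
              RGR.totalKeyDim C d G ∧
            (RGR.totalKeyDim C d G : ℝ) ≤
              b * ((RGR.numEdges G : ℝ) / d * Real.log ((m : ℝ) ^ 2 / RGR.numEdges G))) := by
  -- The constant 12 · 2²⁶ turns both tail bounds into at most 2 m⁻¹².
  refine ⟨fun m d G => RGR.boundedSkew_iff, 12 * 2 ^ 26, by norm_num, 12 * 2 ^ 26, by norm_num,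
    fun C hC => ?_⟩
  have hC1 : (1 : ℝ) ≤ C := le_trans (by norm_num) hC
  have hC0 : (0 : ℝ) ≤ C := by linarith
  -- C / 2 absorbs the factor 2 of log m' ≤ 2 log m and of log (m² / m') ≤ 2 log m. The factors 1 /
  -- δ and 2 / ε come from log m' ≥ δ log m and log (m² / m') ≥ (ε / 2) log m.
  refine ⟨fun m d G h => ⟨h.exists_isPacking, fun M hM => h.separates hC hM⟩,
    ⟨C / 2, by linarith, 2 * (C + 2), by linarith, fun m d G h => ?_⟩, fun δ hδ =>
    ⟨2 * (C + 2) / δ, by positivity, fun m d G h hmδ => ?_⟩, fun ε hε K hK =>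
    ⟨C / 2, by linarith, 2 * (C + 2) * (2 / ε), by positivity, ⌈K ^ (2 / ε)⌉₊,
      fun m d G hm₀ h hmK => ?_⟩⟩
  · have h1 := h.le_totalKeyDim hC0
    have h2 := h.totalKeyDim_le hC0
    have h3 := h.log_numEdges_le
    have h4 := h.log_nonneg
    have hx : 0 ≤ (RGR.numEdges G : ℝ) / d := by positivity
    rw [mul_div_right_comm, mul_div_right_comm]
    refine ⟨?_, h2, ?_⟩
    · refine le_trans ?_ h1
      have : 0 ≤ (RGR.numEdges G : ℝ) / d * Real.log m := mul_nonneg hx h4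
      nlinarith
    · refine le_trans ?_ h1
      have : (RGR.numEdges G : ℝ) / d * Real.log (RGR.numEdges G) ≤
          (RGR.numEdges G : ℝ) / d * (2 * Real.log m) := mul_le_mul_of_nonneg_left h3 hx
      nlinarith
  · have hm' : (0 : ℝ) < m := by exact_mod_cast RGR.pos_of_numEdges_pos h.edges_pos
    have h1 : δ * Real.log m ≤ Real.log (RGR.numEdges G) := by
      rw [← Real.log_rpow hm']
      exact Real.log_le_log (by positivity) hmδ
    rw [mul_div_right_comm (RGR.numEdges G : ℝ)]
    calc (RGR.totalKeyDim C d G : ℝ)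
        ≤ 2 * (C + 2) * ((RGR.numEdges G : ℝ) / d * Real.log m) := h.totalKeyDim_le hC0
      _ = 2 * (C + 2) / δ * ((RGR.numEdges G : ℝ) / d * (δ * Real.log m)) := by field_simp
      _ ≤ _ := by gcongr
  · have hm' : (0 : ℝ) < m := by exact_mod_cast RGR.pos_of_numEdges_pos h.edges_pos
    have hE' : (0 : ℝ) < RGR.numEdges G := by exact_mod_cast h.edges_pos
    have hE1 : (1 : ℝ) ≤ RGR.numEdges G := by exact_mod_cast h.edges_pos
    have hx : 0 ≤ (RGR.numEdges G : ℝ) / d := by positivity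
    have hup : Real.log ((m : ℝ) ^ 2 / RGR.numEdges G) ≤ 2 * Real.log m := by
      rw [Real.log_div (by positivity) hE'.ne', Real.log_pow]
      have := Real.log_nonneg hE1
      push_cast
      linarith
    -- Half of the saving m^ε pays for the constant `K` once m ≥ K^(2/ε); the other half remains as
    -- the lower bound m^(ε/2) for m² / m'.
    have hK' : K ≤ (m : ℝ) ^ (ε / 2) := by
      have h1 : K ^ (2 / ε) ≤ m := (Nat.le_ceil _).trans (by exact_mod_cast hm₀)
      calc K = (K ^ (2 / ε)) ^ (ε / 2) := by
            rw [← Real.rpow_mul hK.le]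
            have : 2 / ε * (ε / 2) = 1 := by field_simp
            rw [this, Real.rpow_one]
        _ ≤ _ := Real.rpow_le_rpow (by positivity) h1 (by positivity)
    have hlow : ε / 2 * Real.log m ≤ Real.log ((m : ℝ) ^ 2 / RGR.numEdges G) := by
      rw [← Real.log_rpow hm']
      refine Real.log_le_log (by positivity) ?_
      rw [le_div_iff₀ hE']
      calc (m : ℝ) ^ (ε / 2) * RGR.numEdges G
          ≤ (m : ℝ) ^ (ε / 2) * (K * (m : ℝ) ^ (2 - ε)) := by gcongr
        _ ≤ (m : ℝ) ^ (ε / 2) * ((m : ℝ) ^ (ε / 2) * (m : ℝ) ^ (2 - ε)) := by gcongr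
        _ = (m : ℝ) ^ 2 := by
            rw [← Real.rpow_add hm', ← Real.rpow_add hm', ← Real.rpow_natCast]
            congr 1
            push_cast
            ring
    constructor
    · refine le_trans ?_ (h.le_totalKeyDim hC0)
      have := mul_le_mul_of_nonneg_left hup hx
      nlinarith
    · calc (RGR.totalKeyDim C d G : ℝ)
          ≤ 2 * (C + 2) * ((RGR.numEdges G : ℝ) / d * Real.log m) := h.totalKeyDim_le hC0
        _ = 2 * (C + 2) * (2 / ε) * ((RGR.numEdges G : ℝ) / d * (ε / 2 * Real.log m)) := by
            field_simp
        _ ≤ _ := by gcongr
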